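/- A real random variable $\xi$ is called subgaussian if there is $B>0$ with $\mathbb P(|\xi|>t)\le 2e^{-t^2/B^2}$ for all $t>0$; the smallest such $B$ is its subgaussian moment. For $\alpha>0$, $\gamma\in(0,1)$ and $a\in\mathbb R^N$ put $$\mathrm{LCD}_{\alpha,\gamma}(a):=\inf\{\theta>0:\ \mathrm{dist}(\theta a,\mathbb Z^N)<\min(\gamma\|\theta a\|_2,\alpha)\}$$ (with $\inf\emptyset=\infty$, and Euclidean distance and norm), and for a linear subspace $E\subseteq\mathbb R^N$ put $$\mathrm{LCD}_{\alpha,\gamma}(E):=\inf\{\mathrm{LCD}_{\alpha,\gamma}(a):\ a\in E,\ \|a\|_2=1\}.$$ **Theorem (Structure of a random subspace).** For every $B$ there exist $c\in(0,1)$ and $\tilde c\in(0,1/2)$, depending only on $B$, such that the following holds. Let $N,m$ be integers with $1\le m<\tilde cN$, and let $H\subseteq\mathbb R^N$ be the random subspace spanned by $N-m$ random vectors whose $N(N-m)$ coordinates are independent and identically distributed subgaussian random variables with mean zero, unit variance and subgaussian moment at most $B$. Then, for $\alpha=c\sqrt N$, $$\mathbb P\bigl(\mathrm{LCD}_{\alpha,c}(H^\perp)<c\sqrt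 N\,e^{cN/m}\bigr)\le e^{-cN}.$$ -/

import Mathlib

open MeasureTheory ProbabilityTheory

noncomputable section

/-- The set of `B > 0` such that `ℙ(|ξ| > t) ≤ 2 exp (-t² / B²)` for all `t > 0`. -/
def subgaussianBounds {Ω : Type*} [MeasurableSpace Ω] (ξ : Ω → ℝ) (μ : Measure Ω) : Set ℝ :=
  {B | 0 < B ∧ ∀ t : ℝ, 0 < t → μ.real {ω | t < |ξ ω|} ≤ 2 * Real.exp (-t ^ 2 / B ^ 2)}

/-- `ξ` is subgaussian: `ℙ(|ξ| > t) ≤ 2 exp (-t² / B²)` for all `t > 0`, for some `B > 0`. -/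
def IsSubgaussian {Ω : Type*} [MeasurableSpace Ω] (ξ : Ω → ℝ) (μ : Measure Ω) : Prop :=
  (subgaussianBounds ξ μ).Nonempty

/-- The subgaussian moment of a subgaussian random variable: the least admissible `B`. -/
def subgaussianMoment {Ω : Type*} [MeasurableSpace Ω] (ξ : Ω → ℝ) (μ : Measure Ω) : ℝ :=
  sInf (subgaussianBounds ξ μ)

/-- The integer points `ℤ^N` of the Euclidean space `ℝ^N`. -/
def integerPoints (N : ℕ) : Set (EuclideanSpace ℝ (Fin N)) :=
  {z | ∀ i, ∃ k : ℤ, z i = (k : ℝ)}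

/-- The essential least common denominator of a vector `a`: the infimum of all `θ > 0` such that
`dist (θ a, ℤ^N) < min (γ ‖θ a‖₂, α)`. It is an extended number, infinite if there is no such
`θ`. -/
def vectorLCD {N : ℕ} (α γ : ℝ) (a : EuclideanSpace ℝ (Fin N)) : ENNReal :=
  ⨅ θ ∈ {θ : ℝ | 0 < θ ∧ Metric.infDist (θ • a) (integerPoints N) < min (γ * ‖θ • a‖) α},
    ENNReal.ofReal θ

/-- The essential least common denominator of a subspace `E`: the infimum of the essential least
common denominators of the unit vectors of `E`. -/
def subspaceLCD {N : ℕ} (α γ : ℝ) (E : Submodule ℝ (EuclideanSpace ℝ (Fin N))) : ENNReal :=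
  ⨅ a ∈ {a : EuclideanSpace ℝ (Fin N) | a ∈ E ∧ ‖a‖ = 1}, vectorLCD α γ a

/-- The subspace of `ℝ^N` spanned by the vectors with coordinates `x i 1, …, x i N`. -/
def rowSpan {n N : ℕ} (x : Fin n → Fin N → ℝ) : Submodule ℝ (EuclideanSpace ℝ (Fin N)) :=
  Submodule.span ℝ (Set.range fun i => WithLp.toLp 2 (x i))

end

/-! The random vectors are the `n = N - m` rows of a matrix `A`, and `H^⊥` lies in its kernel. A
small denominator of `H^⊥` thus yields a unit vector `x` with `A x = 0` and some `θ x` close to a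
lattice point `z`. Outside an event of probability at most `e^{-N}` one has `‖A‖ ≤ K √N`
(`matLaw_opNorm_le`), so `A` is small at every vector close to `z / ‖z‖`. A union bound over `z`
then competes with the probability that one fixed vector is nearly annihilated.

Vectors with a denominator `θ < lm √N` involve only `e^{εN}` lattice points, which is beaten by a
bound `e^{-c' n}` valid for every unit vector (`lintegral_exp_neg_sq_rowDot_le`). The others are
split into dyadic levels. At scale `D = x √N` there are at most `(C₁ x)^N` lattice points, while a
vector without denominators below `D` loses a factor of order `C₃ μ / x` per row
(`IsStdSubgaussian.small_ball`). The product is `(C₁ e C₃ μ)^n (C₁ x)^m`: the scale survives only to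
the power `m`, which is why denominators up to `√N e^{cN/m}` can be excluded, and a small `μ`
settles the rest (`pow_mul_exp_mul_pow_le`).

The small ball estimate writes `e^{-κX²}` as a Gaussian average of `e^{ibX}`. Symmetrization bounds
the characteristic function of a row product by `exp(-4 E dist²)`, with `dist` the distance from
multiples of `y` to the lattice. In a short window of multiples, this distance is compared with its
minimum there; the absence of small denominators forces growth away from the minimizer
(`FarFromLattice.lintegral_gaussian_le`). -/

noncomputable section

/-! ### Moments and exponential moments of a one-dimensional law. -/

/-- A law on `ℝ` which is centred with unit second moment and satisfies
`∫ exp (lam x²) ≤ 3`. -/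
structure IsStdSubgaussian (ν : Measure ℝ) (lam : ℝ) : Prop where
  lam_pos : 0 < lam
  mean : ∫ x, x ∂ν = 0
  second : ∫ x, x ^ 2 ∂ν = 1
  expSq : ∫⁻ x, ENNReal.ofReal (Real.exp (lam * x ^ 2)) ∂ν ≤ 3

lemma exp_le_add_exp_sq (x : ℝ) : Real.exp x ≤ x + Real.exp (x ^ 2) := by
  have h2 := Real.add_one_le_exp (x ^ 2)
  rcases le_or_gt |x| 1 with h | h
  · have := Real.abs_exp_sub_one_sub_id_le h
    have := abs_le.1 this
    linarith [this.2]
  · rcases lt_abs.1 h with h | h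
    · have : Real.exp x ≤ Real.exp (x ^ 2) := Real.exp_le_exp.2 (by nlinarith)
      linarith
    · have : Real.exp x ≤ 1 := Real.exp_le_one_iff.2 (by linarith)
      nlinarith

namespace IsStdSubgaussian

variable {ν : Measure ℝ} {lam : ℝ}

lemma integrable_exp_sq (h : IsStdSubgaussian ν lam) :
    Integrable (fun x => Real.exp (lam * x ^ 2)) ν := by
  refine ⟨by fun_prop, ?_⟩
  rw [hasFiniteIntegral_iff_ofReal (ae_of_all _ fun x => (Real.exp_pos _).le)]
  exact h.expSq.trans_lt (by simp)

lemma integral_exp_sq_le (h : IsStdSubgaussian ν lam) :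
    ∫ x, Real.exp (lam * x ^ 2) ∂ν ≤ 3 := by
  rw [integral_eq_lintegral_of_nonneg_ae (ae_of_all _ fun x => (Real.exp_pos _).le) (by fun_prop)]
  exact ENNReal.toReal_le_of_le_ofReal (by norm_num) (by simpa using h.expSq)

lemma integrable_pow_four (h : IsStdSubgaussian ν lam) : Integrable (fun x => x ^ 4) ν := by
  have hl := h.lam_pos
  refine (h.integrable_exp_sq.const_mul (2 / lam ^ 2)).mono' (by fun_prop) (ae_of_all _ fun x => ?_)
  have := Real.quadratic_le_exp_of_nonneg (x := lam * x ^ 2) (by positivity)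
  rw [Real.norm_of_nonneg (by positivity), div_mul_eq_mul_div, le_div_iff₀ (by positivity)]
  nlinarith [mul_nonneg hl.le (sq_nonneg x)]

lemma integral_pow_four_le (h : IsStdSubgaussian ν lam) : ∫ x, x ^ 4 ∂ν ≤ 6 / lam ^ 2 := by
  have hl := h.lam_pos
  calc ∫ x, x ^ 4 ∂ν ≤ ∫ x, (2 / lam ^ 2) * Real.exp (lam * x ^ 2) ∂ν := by
        refine integral_mono h.integrable_pow_four (h.integrable_exp_sq.const_mul _) fun x => ?_
        have := Real.quadratic_le_exp_of_nonneg (x := lam * x ^ 2) (by positivity)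
        simp only
        rw [div_mul_eq_mul_div, le_div_iff₀ (by positivity)]
        nlinarith [mul_nonneg hl.le (sq_nonneg x)]
    _ = (2 / lam ^ 2) * ∫ x, Real.exp (lam * x ^ 2) ∂ν := integral_const_mul _ _
    _ ≤ (2 / lam ^ 2) * 3 := by gcongr; exact h.integral_exp_sq_le
    _ = _ := by ring

lemma integrable_id [IsProbabilityMeasure ν] (h : IsStdSubgaussian ν lam) :
    Integrable (fun x : ℝ => x) ν := by
  refine ((integrable_const (1 : ℝ)).add h.integrable_pow_four).mono' (by fun_prop)
    (ae_of_all _ fun x => ?_)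
  simp only [Real.norm_eq_abs, Pi.add_apply]
  rw [abs_le]; constructor <;> nlinarith [sq_nonneg (x ^ 2 - 1), sq_nonneg (x - 1),
    sq_nonneg (x + 1),
    sq_nonneg (x ^ 2 - 1/2)]

lemma integrable_sq [IsProbabilityMeasure ν] (h : IsStdSubgaussian ν lam) :
    Integrable (fun x : ℝ => x ^ 2) ν := by
  refine ((integrable_const (1 : ℝ)).add h.integrable_pow_four).mono' (by fun_prop)
    (ae_of_all _ fun x => ?_)
  rw [Real.norm_of_nonneg (by positivity)]
  simp only [Pi.add_apply]
  nlinarith [sq_nonneg (x ^ 2 - 1)]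

lemma integrable_exp_mul (h : IsStdSubgaussian ν lam) (s : ℝ) :
    Integrable (fun x => Real.exp (s * x)) ν := by
  have hl := h.lam_pos
  refine (h.integrable_exp_sq.const_mul (Real.exp (s ^ 2 / (4 * lam)))).mono' (by fun_prop)
    (ae_of_all _ fun x => ?_)
  rw [Real.norm_of_nonneg (Real.exp_pos _).le, ← Real.exp_add, Real.exp_le_exp]
  have : s ^ 2 / (4 * lam) + lam * x ^ 2 - s * x = (s / 2 - lam * x) ^ 2 / lam := by
    field_simp; ring
  have : 0 ≤ (s / 2 - lam * x) ^ 2 / lam := by positivity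
  linarith

/-- For `s ^ 2 ≤ lam`, the linear term of `exp_le_add_exp_sq` has mean zero and convexity of `exp`
between `0` and `lam * x ^ 2` handles the rest. For larger `s`, completing the square suffices, and
the factor `3` is absorbed into the exponent. -/
lemma mgf_le [IsProbabilityMeasure ν] (h : IsStdSubgaussian ν lam) (s : ℝ) :
    ∫ x, Real.exp (s * x) ∂ν ≤ Real.exp (2 / lam * s ^ 2) := by
  have hl := h.lam_pos
  rcases le_or_gt (s ^ 2) lam with hs | hs
  · have hr : s ^ 2 / lam ≤ 1 := (div_le_one hl).2 hs
    have hr0 : 0 ≤ s ^ 2 / lam := by positivity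
    calc ∫ x, Real.exp (s * x) ∂ν
        ≤ ∫ x, (s * x + ((1 - s ^ 2 / lam) + s ^ 2 / lam * Real.exp (lam * x ^ 2))) ∂ν := by
          refine integral_mono (h.integrable_exp_mul s) ((h.integrable_id.const_mul s).add
            ((integrable_const _).add (h.integrable_exp_sq.const_mul _))) fun x => ?_
          refine (exp_le_add_exp_sq (s * x)).trans ?_
          have := convexOn_exp.2 (Set.mem_univ (0 : ℝ)) (Set.mem_univ (lam * x ^ 2))
            (sub_nonneg.2 hr) hr0 (by ring)
          simp only [smul_eq_mul, mul_zero, zero_add, Real.exp_zero, mul_one] at this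
          rw [show s ^ 2 / lam * (lam * x ^ 2) = (s * x) ^ 2 by field_simp] at this
          simpa using this
      _ = (1 - s ^ 2 / lam) + s ^ 2 / lam * ∫ x, Real.exp (lam * x ^ 2) ∂ν := by
          have hi : Integrable (fun x => (1 - s ^ 2 / lam)
              + s ^ 2 / lam * Real.exp (lam * x ^ 2)) ν :=
            (integrable_const _).add (h.integrable_exp_sq.const_mul _)
          rw [integral_add (h.integrable_id.const_mul s) hi, integral_const_mul, h.mean,
            integral_add (integrable_const _) (h.integrable_exp_sq.const_mul _),
            integral_const_mul]
          simp
      _ ≤ (1 - s ^ 2 / lam) + s ^ 2 / lam * 3 := by gcongr; exact h.integral_exp_sq_le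
      _ = 2 / lam * s ^ 2 + 1 := by ring
      _ ≤ _ := Real.add_one_le_exp _
  · have hr : 1 ≤ s ^ 2 / lam := (one_le_div hl).2 hs.le
    calc ∫ x, Real.exp (s * x) ∂ν
        ≤ ∫ x, Real.exp (s ^ 2 / (4 * lam)) * Real.exp (lam * x ^ 2) ∂ν := by
          refine integral_mono (h.integrable_exp_mul s) (h.integrable_exp_sq.const_mul _)
            fun x => ?_
          simp only
          rw [← Real.exp_add, Real.exp_le_exp]
          have : s ^ 2 / (4 * lam) + lam * x ^ 2 - s * x = (s / 2 - lam * x) ^ 2 / lam := by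
            field_simp; ring
          have : 0 ≤ (s / 2 - lam * x) ^ 2 / lam := by positivity
          linarith
      _ ≤ Real.exp (s ^ 2 / (4 * lam)) * 3 := by
          rw [integral_const_mul]; gcongr; exact h.integral_exp_sq_le
      _ ≤ Real.exp (s ^ 2 / (4 * lam)) * Real.exp (7 / 4 * (s ^ 2 / lam)) := by
          gcongr
          have := Real.quadratic_le_exp_of_nonneg (x := 7 / 4 * (s ^ 2 / lam)) (by positivity)
          nlinarith
      _ = _ := by rw [← Real.exp_add]; congr 1; field_simp; ring

end IsStdSubgaussian

/-! ### Product laws and Gaussian integrals. -/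

lemma lintegral_prod_pi {ι E : Type*} [Fintype ι] [MeasurableSpace E] (ν : Measure E)
    [IsProbabilityMeasure ν] {f : ι → E → ENNReal} (hf : ∀ i, Measurable (f i)) :
    ∫⁻ v, ∏ i, f i (v i) ∂(Measure.pi fun _ : ι => ν) = ∏ i, ∫⁻ x, f i x ∂ν := by
  have := lintegral_prod_eq_prod_lintegral_of_indepFun (μ := Measure.pi fun _ : ι => ν)
    Finset.univ (fun i v => f i (v i)) (iIndepFun_pi fun i => (hf i).aemeasurable)
    (fun i => (hf i).comp (measurable_pi_apply i))
  rw [this]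
  refine Finset.prod_congr rfl fun i _ => ?_
  exact (measurePreserving_eval (fun _ : ι => ν) i).lintegral_comp (hf i)

lemma lintegral_exp_mul_gaussian (b : ℝ) :
    ∫⁻ g, ENNReal.ofReal (Real.exp (b * g)) ∂(gaussianReal 0 1)
      = ENNReal.ofReal (Real.exp (b ^ 2 / 2)) := by
  rw [← ofReal_integral_eq_lintegral_ofReal (integrable_exp_mul_gaussianReal b)
    (ae_of_all _ fun x => (Real.exp_pos _).le)]
  have := congrFun (mgf_id_gaussianReal (μ := 0) (v := 1)) b
  simp only [mgf, id] at this
  rw [this]; simp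

lemma lintegral_gaussianReal {f : ℝ → ENNReal} (hf : Measurable f) :
    ∫⁻ g, f g ∂(gaussianReal 0 1)
      = ∫⁻ g, ENNReal.ofReal ((√(2 * Real.pi))⁻¹ * Real.exp (-g ^ 2 / 2)) * f g := by
  rw [gaussianReal_of_var_ne_zero _ one_ne_zero,
    lintegral_withDensity_eq_lintegral_mul _ (measurable_gaussianPDF _ _) hf]
  simp [gaussianPDF, gaussianPDFReal]

lemma lintegral_exp_neg_mul_sq {b : ℝ} (hb : 0 < b) :
    ∫⁻ x : ℝ, ENNReal.ofReal (Real.exp (-b * x ^ 2)) = ENNReal.ofReal √(Real.pi / b) := by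
  rw [← ofReal_integral_eq_lintegral_ofReal (integrable_exp_neg_mul_sq hb)
    (ae_of_all _ fun x => (Real.exp_pos _).le), integral_gaussian]

lemma lintegral_exp_sq_gaussian_le :
    ∫⁻ g, ENNReal.ofReal (Real.exp (g ^ 2 / 4)) ∂(gaussianReal 0 1) ≤ 2 := by
  rw [lintegral_gaussianReal (by fun_prop)]
  have h1 : ∀ g : ℝ, ENNReal.ofReal ((√(2 * Real.pi))⁻¹ * Real.exp (-g ^ 2 / 2))
      * ENNReal.ofReal (Real.exp (g ^ 2 / 4))
      = ENNReal.ofReal (√(2 * Real.pi))⁻¹ * ENNReal.ofReal (Real.exp (-(1 / 4) * g ^ 2)) := by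
    intro g
    rw [← ENNReal.ofReal_mul (by positivity), ← ENNReal.ofReal_mul (by positivity), mul_assoc,
      ← Real.exp_add]
    congr 3; ring
  simp_rw [h1]
  rw [lintegral_const_mul _ (by fun_prop), lintegral_exp_neg_mul_sq (by norm_num),
    ← ENNReal.ofReal_mul (by positivity)]
  refine (ENNReal.ofReal_le_ofReal (q := 2) ?_).trans (by simp)
  have : Real.pi / (1 / 4) = 2 * (2 * Real.pi) := by ring
  rw [this, Real.sqrt_mul (by norm_num) (2 * Real.pi), mul_comm, mul_assoc,
    mul_inv_cancel₀ (by positivity), mul_one]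
  rw [Real.sqrt_le_left (by norm_num)]; norm_num

/-! ### Random rows and matrices: Laplace transforms and union bounds. -/

/-- The scalar product of a row `v` with `y`. -/
def rowDot {N : ℕ} (y : EuclideanSpace ℝ (Fin N)) (v : Fin N → ℝ) : ℝ := ∑ j, v j * y j

/-- The law of a row with independent coordinates of law `ν`. -/
abbrev rowLaw (ν : Measure ℝ) (N : ℕ) : Measure (Fin N → ℝ) := Measure.pi fun _ => ν

/-- The law of a matrix with independent entries of law `ν`. -/
abbrev matLaw (ν : Measure ℝ) (n N : ℕ) : Measure (Fin n → Fin N → ℝ) :=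
  Measure.pi fun _ => rowLaw ν N

/-- The linear map given by a matrix, between Euclidean spaces. -/
def matMap {n N : ℕ} (A : Fin n → Fin N → ℝ) :
    EuclideanSpace ℝ (Fin N) →L[ℝ] EuclideanSpace ℝ (Fin n) :=
  LinearMap.toContinuousLinearMap (Matrix.toEuclideanLin (Matrix.of A))

lemma matMap_apply {n N : ℕ} (A : Fin n → Fin N → ℝ) (y : EuclideanSpace ℝ (Fin N)) (k : Fin n) :
    matMap A y k = rowDot y (A k) := by
  simp [matMap, rowDot, Matrix.toLpLin_apply, Matrix.mulVec, dotProduct]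

lemma norm_matMap_sq {n N : ℕ} (A : Fin n → Fin N → ℝ) (y : EuclideanSpace ℝ (Fin N)) :
    ‖matMap A y‖ ^ 2 = ∑ k, rowDot y (A k) ^ 2 := by
  rw [EuclideanSpace.real_norm_sq_eq]
  simp_rw [matMap_apply]

@[fun_prop]
lemma measurable_rowDot {N : ℕ} (y : EuclideanSpace ℝ (Fin N)) : Measurable (rowDot y) := by
  unfold rowDot; fun_prop

lemma matMap_eq_zero_of_mem {n N : ℕ} {A : Fin n → Fin N → ℝ} {y : EuclideanSpace ℝ (Fin N)}
    (hy : y ∈ (rowSpan A)ᗮ) : matMap A y = 0 := by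
  ext k
  rw [matMap_apply]
  have := (Submodule.mem_orthogonal _ y).1 hy (WithLp.toLp 2 (A k))
    (Submodule.subset_span ⟨k, rfl⟩)
  simp only [PiLp.inner_apply, RCLike.inner_apply, conj_trivial] at this
  simp only [rowDot, PiLp.zero_apply]
  rw [← this]
  exact Finset.sum_congr rfl fun j _ => mul_comm _ _

section Rows

variable {ν : Measure ℝ} [IsProbabilityMeasure ν] {lam : ℝ} {N : ℕ}

lemma lintegral_exp_rowDot_le (h : IsStdSubgaussian ν lam) (y : EuclideanSpace ℝ (Fin N)) (s : ℝ) :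
    ∫⁻ v, ENNReal.ofReal (Real.exp (s * rowDot y v)) ∂rowLaw ν N
      ≤ ENNReal.ofReal (Real.exp (2 / lam * s ^ 2 * ‖y‖ ^ 2)) := by
  have h1 : ∀ v : Fin N → ℝ, ENNReal.ofReal (Real.exp (s * rowDot y v))
      = ∏ j, ENNReal.ofReal (Real.exp (s * y j * v j)) := by
    intro v
    rw [← ENNReal.ofReal_prod_of_nonneg fun _ _ => (Real.exp_pos _).le, ← Real.exp_sum, rowDot,
      Finset.mul_sum]
    congr 2
    exact Finset.sum_congr rfl fun j _ => by ring
  simp_rw [h1]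
  rw [lintegral_prod_pi ν (f := fun j x => ENNReal.ofReal (Real.exp (s * y j * x)))
    fun j => by fun_prop]
  calc ∏ j, ∫⁻ x, ENNReal.ofReal (Real.exp (s * y j * x)) ∂ν
      ≤ ∏ j, ENNReal.ofReal (Real.exp (2 / lam * (s * y j) ^ 2)) := by
        refine Finset.prod_le_prod' fun j _ => ?_
        rw [← ofReal_integral_eq_lintegral_ofReal (h.integrable_exp_mul _)
          (ae_of_all _ fun x => (Real.exp_pos _).le)]
        exact ENNReal.ofReal_le_ofReal (h.mgf_le _)
    _ = _ := by
        rw [← ENNReal.ofReal_prod_of_nonneg fun _ _ => (Real.exp_pos _).le, ← Real.exp_sum,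
          EuclideanSpace.real_norm_sq_eq, Finset.mul_sum]
        congr 2
        exact Finset.sum_congr rfl fun j _ => by ring

/-- Gaussian linearization: `e^{τX²}` is the average of `e^{√(2τ) g X}` over a standard Gaussian
`g`, which reduces the square to the factorizing exponential moment. -/
lemma lintegral_exp_sq_rowDot_le (h : IsStdSubgaussian ν lam) {y : EuclideanSpace ℝ (Fin N)}
    {τ : ℝ} (hτ : 0 ≤ τ) (hy : 16 * τ * ‖y‖ ^ 2 ≤ lam) :
    ∫⁻ v, ENNReal.ofReal (Real.exp (τ * rowDot y v ^ 2)) ∂rowLaw ν N ≤ 2 := by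
  have hl := h.lam_pos
  have h1 : ∀ v : Fin N → ℝ, ENNReal.ofReal (Real.exp (τ * rowDot y v ^ 2))
      = ∫⁻ g, ENNReal.ofReal (Real.exp (√(2 * τ) * rowDot y v * g)) ∂(gaussianReal 0 1) := by
    intro v
    rw [lintegral_exp_mul_gaussian, mul_pow, Real.sq_sqrt (by positivity)]
    congr 2; ring
  simp_rw [h1]
  rw [lintegral_lintegral_swap (by fun_prop)]
  refine (lintegral_mono fun g => ?_).trans lintegral_exp_sq_gaussian_le
  calc ∫⁻ v, ENNReal.ofReal (Real.exp (√(2 * τ) * rowDot y v * g)) ∂rowLaw ν N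
      = ∫⁻ v, ENNReal.ofReal (Real.exp ((√(2 * τ) * g) * rowDot y v)) ∂rowLaw ν N := by
        simp_rw [mul_right_comm]
    _ ≤ _ := lintegral_exp_rowDot_le h y _
    _ ≤ _ := by
        refine ENNReal.ofReal_le_ofReal (Real.exp_le_exp.2 ?_)
        rw [mul_pow, Real.sq_sqrt (by positivity)]
        have : 2 / lam * (2 * τ * g ^ 2) * ‖y‖ ^ 2 = (16 * τ * ‖y‖ ^ 2) / lam * (g ^ 2 / 4) := by
          field_simp; ring
        rw [this]
        exact mul_le_of_le_one_left (by positivity) ((div_le_one hl).2 hy)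

lemma integral_sq_rowDot (h : IsStdSubgaussian ν lam) {y : EuclideanSpace ℝ (Fin N)}
    (hy : ‖y‖ = 1) : ∫ v, rowDot y v ^ 2 ∂rowLaw ν N = 1 := by
  have hL : ∀ j, MemLp (fun x : ℝ => x * y j) 2 ν := fun j =>
    ((memLp_two_iff_integrable_sq (by fun_prop)).2 h.integrable_sq).mul_const (y j)
  have hv := variance_sum_pi (μ := fun _ : Fin N => ν) (X := fun j x => x * y j) hL
  have hS : (∑ j, fun v : Fin N → ℝ => v j * y j) = rowDot y := by
    ext v; simp [rowDot]
  rw [hS] at hv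
  have hm : ∫ v, rowDot y v ∂rowLaw ν N = 0 := by
    simp only [rowDot]
    rw [integral_finsetSum]
    · refine Finset.sum_eq_zero fun j _ => ?_
      rw [integral_mul_const, integral_comp_eval (μ := fun _ : Fin N => ν) (f := fun x : ℝ => x)
        (by fun_prop), h.mean, zero_mul]
    · intro j _
      exact (integrable_comp_eval (μ := fun _ : Fin N => ν) (f := fun x : ℝ => x)
        h.integrable_id).mul_const _
  rw [variance_of_integral_eq_zero (by fun_prop) hm] at hv
  rw [hv, ← one_pow 2, ← hy, EuclideanSpace.real_norm_sq_eq]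
  refine Finset.sum_congr rfl fun j _ => ?_
  rw [variance_of_integral_eq_zero (by fun_prop) (by rw [integral_mul_const, h.mean, zero_mul])]
  simp_rw [mul_pow]
  rw [integral_mul_const, h.second, one_mul]

/-- Second order expansion of `e^{-u}`: the linear term has mean exactly known from the unit
variance, and the quadratic one is dominated by an exponential moment. The gain per row does not
depend on the arithmetic of `y`. -/
lemma lintegral_exp_neg_sq_rowDot_le (h : IsStdSubgaussian ν lam)
    {y : EuclideanSpace ℝ (Fin N)} (hy : ‖y‖ = 1) :
    ∫⁻ v, ENNReal.ofReal (Real.exp (-(lam ^ 2 / 1024) * rowDot y v ^ 2)) ∂rowLaw ν N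
      ≤ ENNReal.ofReal (Real.exp (-(lam ^ 2 / 2048))) := by
  have hl := h.lam_pos
  have hF := lintegral_exp_sq_rowDot_le h (y := y) (τ := lam / 16) (by positivity)
    (by rw [hy]; linarith)
  have hi : Integrable (fun v => Real.exp (lam / 16 * rowDot y v ^ 2)) (rowLaw ν N) := by
    refine ⟨by fun_prop, ?_⟩
    rw [hasFiniteIntegral_iff_ofReal (ae_of_all _ fun x => (Real.exp_pos _).le)]
    exact hF.trans_lt (by simp)
  have hi2 : ∫ v, Real.exp (lam / 16 * rowDot y v ^ 2) ∂rowLaw ν N ≤ 2 := by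
    rw [integral_eq_lintegral_of_nonneg_ae (ae_of_all _ fun x => (Real.exp_pos _).le)
      (by fun_prop)]
    exact ENNReal.toReal_le_of_le_ofReal (by norm_num) (by simpa using hF)
  -- The integral of a nonintegrable function is `0` by convention, whereas this one equals `1`.
  have hsq : Integrable (fun v => rowDot y v ^ 2) (rowLaw ν N) := by
    by_contra hc
    have := integral_undef hc
    rw [integral_sq_rowDot h hy] at this
    exact one_ne_zero this
  have key : ∀ v, Real.exp (-(lam ^ 2 / 1024) * rowDot y v ^ 2)
      ≤ 1 - lam ^ 2 / 1024 * rowDot y v ^ 2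
        + lam ^ 2 / 4096 * Real.exp (lam / 16 * rowDot y v ^ 2) := by
    intro v
    set w := rowDot y v ^ 2 with hw
    have hw0 : 0 ≤ w := sq_nonneg _
    have h1 : Real.exp (-(lam ^ 2 / 1024 * w)) ≤ 1 - lam ^ 2 / 1024 * w
        + (lam ^ 2 / 1024 * w) ^ 2 / 2 := by
      have hx : 0 ≤ lam ^ 2 / 1024 * w := by positivity
      generalize lam ^ 2 / 1024 * w = x at hx
      have h3 := Real.quadratic_le_exp_of_nonneg hx
      rw [Real.exp_neg, inv_le_iff_one_le_mul₀ (Real.exp_pos _)]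
      have : (1 - x + x ^ 2 / 2) * (1 + x + x ^ 2 / 2) = 1 + x ^ 4 / 4 := by ring
      have h0 : 0 ≤ 1 - x + x ^ 2 / 2 := by nlinarith [sq_nonneg (x - 1)]
      nlinarith [mul_le_mul_of_nonneg_left h3 h0, sq_nonneg (x ^ 2)]
    have h2 := Real.quadratic_le_exp_of_nonneg (x := lam / 16 * w) (by positivity)
    have h3 : (lam / 16 * w) ^ 2 / 2 ≤ Real.exp (lam / 16 * w) := by
      have : 0 ≤ lam / 16 * w := by positivity
      linarith
    rw [neg_mul]
    refine h1.trans ?_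
    have : (lam ^ 2 / 1024 * w) ^ 2 / 2 = lam ^ 2 / 4096 * ((lam / 16 * w) ^ 2 / 2) := by ring
    rw [this]
    gcongr
  have hi3 : Integrable (fun v => Real.exp (-(lam ^ 2 / 1024) * rowDot y v ^ 2))
      (rowLaw ν N) := by
    refine (integrable_const (1 : ℝ)).mono' (by fun_prop) (ae_of_all _ fun v => ?_)
    rw [Real.norm_of_nonneg (Real.exp_pos _).le, Real.exp_le_one_iff, neg_mul, neg_nonpos]
    positivity
  rw [← ofReal_integral_eq_lintegral_ofReal hi3 (ae_of_all _ fun x => (Real.exp_pos _).le)]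
  refine ENNReal.ofReal_le_ofReal ?_
  have hA : Integrable (fun v => 1 - lam ^ 2 / 1024 * rowDot y v ^ 2) (rowLaw ν N) :=
    (integrable_const _).sub (hsq.const_mul _)
  calc _ ≤ ∫ v, (1 - lam ^ 2 / 1024 * rowDot y v ^ 2
        + lam ^ 2 / 4096 * Real.exp (lam / 16 * rowDot y v ^ 2)) ∂rowLaw ν N :=
        integral_mono hi3 (hA.add (hi.const_mul _)) key
    _ = 1 - lam ^ 2 / 1024
        + lam ^ 2 / 4096 * ∫ v, Real.exp (lam / 16 * rowDot y v ^ 2) ∂rowLaw ν N := by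
        rw [integral_add hA (hi.const_mul _), integral_const_mul,
          integral_sub (integrable_const _) (hsq.const_mul _), integral_const_mul,
          integral_sq_rowDot h hy]
        simp
    _ ≤ 1 - lam ^ 2 / 1024 + lam ^ 2 / 4096 * 2 := by gcongr
    _ = -(lam ^ 2 / 2048) + 1 := by ring
    _ ≤ _ := Real.add_one_le_exp _

/-- Exponential Markov inequality for the sum of squares of the coordinates of `A y`. -/
lemma matLaw_sum_sq_le {n : ℕ} (y : EuclideanSpace ℝ (Fin N)) {κ q : ℝ} (w : ℝ)
    (hq : ∫⁻ v, ENNReal.ofReal (Real.exp (-κ * rowDot y v ^ 2)) ∂rowLaw ν N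
      ≤ ENNReal.ofReal q) (hq0 : 0 ≤ q) :
    matLaw ν n N {A | κ * ∑ k, rowDot y (A k) ^ 2 ≤ w} ≤ ENNReal.ofReal (Real.exp w * q ^ n) := by
  have hmeas : Measurable fun A : Fin n → Fin N → ℝ =>
      ENNReal.ofReal (Real.exp (-κ * ∑ k, rowDot y (A k) ^ 2)) := by fun_prop
  have h1 := mul_meas_ge_le_lintegral (μ := matLaw ν n N) hmeas (ENNReal.ofReal (Real.exp (-w)))
  have h2 : ∫⁻ A, ENNReal.ofReal (Real.exp (-κ * ∑ k, rowDot y (A k) ^ 2)) ∂matLaw ν n N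
      ≤ ENNReal.ofReal (q ^ n) := by
    have : ∀ A : Fin n → Fin N → ℝ,
        ENNReal.ofReal (Real.exp (-κ * ∑ k, rowDot y (A k) ^ 2))
          = ∏ k, ENNReal.ofReal (Real.exp (-κ * rowDot y (A k) ^ 2)) := by
      intro A
      rw [← ENNReal.ofReal_prod_of_nonneg fun _ _ => (Real.exp_pos _).le, ← Real.exp_sum,
        Finset.mul_sum]
    simp_rw [this]
    rw [lintegral_prod_pi (rowLaw ν N)
      (f := fun _ v => ENNReal.ofReal (Real.exp (-κ * rowDot y v ^ 2))) fun _ => by fun_prop,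
      Finset.prod_const, Finset.card_univ, Fintype.card_fin, ENNReal.ofReal_pow hq0]
    gcongr
  have h3 : {A : Fin n → Fin N → ℝ | κ * ∑ k, rowDot y (A k) ^ 2 ≤ w}
      ⊆ {A | ENNReal.ofReal (Real.exp (-w))
        ≤ ENNReal.ofReal (Real.exp (-κ * ∑ k, rowDot y (A k) ^ 2))} := by
    intro A hA
    refine ENNReal.ofReal_le_ofReal (Real.exp_le_exp.2 ?_)
    have : κ * ∑ k, rowDot y (A k) ^ 2 ≤ w := hA
    linarith
  have h4 := h1.trans h2
  calc matLaw ν n N {A | κ * ∑ k, rowDot y (A k) ^ 2 ≤ w}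
      ≤ matLaw ν n N {A | ENNReal.ofReal (Real.exp (-w))
        ≤ ENNReal.ofReal (Real.exp (-κ * ∑ k, rowDot y (A k) ^ 2))} := measure_mono h3
    _ = ENNReal.ofReal (Real.exp w) * (ENNReal.ofReal (Real.exp (-w)) * matLaw ν n N
        {A | ENNReal.ofReal (Real.exp (-w))
        ≤ ENNReal.ofReal (Real.exp (-κ * ∑ k, rowDot y (A k) ^ 2))}) := by
        rw [← mul_assoc, ← ENNReal.ofReal_mul (Real.exp_pos _).le, ← Real.exp_add]
        simp
    _ ≤ ENNReal.ofReal (Real.exp w) * ENNReal.ofReal (q ^ n) := by gcongr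
    _ = _ := by rw [ENNReal.ofReal_mul (Real.exp_pos _).le]

/-- The union bound behind all three estimates. `κ` may be negative, which gives an upper tail (for
the operator norm), and `E` need not be measurable. -/
lemma matLaw_le_card_mul {n : ℕ} {ι : Type*} (T : Finset ι) (y : ι → EuclideanSpace ℝ (Fin N))
    {κ q w : ℝ} (hq : ∀ p ∈ T, ∫⁻ v, ENNReal.ofReal (Real.exp (-κ * rowDot (y p) v ^ 2))
      ∂rowLaw ν N ≤ ENNReal.ofReal q) (hq0 : 0 ≤ q) {E : Set (Fin n → Fin N → ℝ)}
    (hE : ∀ A ∈ E, ∃ p ∈ T, κ * ∑ k, rowDot (y p) (A k) ^ 2 ≤ w) :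
    matLaw ν n N E ≤ ENNReal.ofReal (T.card * (Real.exp w * q ^ n)) := by
  have hsub : E ⊆ ⋃ p ∈ T, {A | κ * ∑ k, rowDot (y p) (A k) ^ 2 ≤ w} := fun A hA => by
    obtain ⟨p, hp, h⟩ := hE A hA
    exact Set.mem_biUnion hp h
  calc _ ≤ ∑ p ∈ T, matLaw ν n N {A | κ * ∑ k, rowDot (y p) (A k) ^ 2 ≤ w} :=
        (measure_mono hsub).trans (measure_biUnion_finset_le _ _)
    _ ≤ ∑ p ∈ T, ENNReal.ofReal (Real.exp w * q ^ n) :=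
        Finset.sum_le_sum fun p hp => matLaw_sum_sq_le _ _ (hq p hp) hq0
    _ = _ := by
        rw [Finset.sum_const, nsmul_eq_mul, ENNReal.ofReal_mul (Nat.cast_nonneg _),
          ENNReal.ofReal_natCast]

end Rows

/-! ### Counting lattice points, and a net for the operator norm. -/

/-- An integer vector as a point of the Euclidean space. -/
def intVec {N : ℕ} (p : Fin N → ℤ) : EuclideanSpace ℝ (Fin N) := WithLp.toLp 2 fun i => (p i : ℝ)

lemma intVec_mem {N : ℕ} (p : Fin N → ℤ) : intVec p ∈ integerPoints N := fun i => ⟨p i, rfl⟩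

lemma exists_intVec_eq {N : ℕ} {z : EuclideanSpace ℝ (Fin N)} (hz : z ∈ integerPoints N) :
    ∃ p, z = intVec p := by
  choose p hp using hz
  exact ⟨p, by ext i; simp [intVec, hp]⟩

/-- The integer vectors of Euclidean norm at most `R`. -/
def latticeBall (N : ℕ) (R : ℝ) : Finset (Fin N → ℤ) :=
  {p ∈ Fintype.piFinset fun _ => Finset.Icc (-(⌊R⌋₊ : ℤ)) ⌊R⌋₊ | ‖intVec p‖ ≤ R}

lemma mem_latticeBall {N : ℕ} {R : ℝ} {p : Fin N → ℤ} : p ∈ latticeBall N R ↔ ‖intVec p‖ ≤ R := by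
  refine ⟨fun h => (Finset.mem_filter.1 h).2, fun h => Finset.mem_filter.2 ⟨?_, h⟩⟩
  rw [Fintype.mem_piFinset]
  intro i
  have h1 : |(p i : ℝ)| ≤ R := (PiLp.norm_apply_le (intVec p) i).trans h
  have h2 : (p i).natAbs ≤ ⌊R⌋₊ := Nat.le_floor (by rwa [Nat.cast_natAbs, Int.cast_abs])
  rw [Finset.mem_Icc]
  omega

lemma sum_exp_neg_abs_le {s : ℝ} (hs : 0 < s) (M : ℕ) :
    ∑ k ∈ Finset.Icc (-(M : ℤ)) M, Real.exp (-s * |(k : ℝ)|)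
      ≤ 1 + 2 / (Real.exp s - 1) := by
  have he : 0 < Real.exp s - 1 := by have := Real.add_one_lt_exp hs.ne'; linarith
  have key : ∑ k ∈ Finset.Icc (-(M : ℤ)) M, Real.exp (-s * |(k : ℝ)|)
      = 1 + 2 / (Real.exp s - 1) * (1 - Real.exp (-s * M)) := by
    induction M with
    | zero => simp
    | succ M ih =>
      have hI : Finset.Icc (-((M + 1 : ℕ) : ℤ)) ((M + 1 : ℕ) : ℤ)
          = insert (-((M : ℤ) + 1)) (insert ((M : ℤ) + 1) (Finset.Icc (-(M : ℤ)) M)) := by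
        ext k; simp only [Finset.mem_insert, Finset.mem_Icc]; push_cast; omega
      rw [hI, Finset.sum_insert (by simp only [Finset.mem_insert, Finset.mem_Icc]; omega),
        Finset.sum_insert (by simp only [Finset.mem_Icc]; omega), ih]
      have h1 : |((-((M : ℤ) + 1) : ℤ) : ℝ)| = M + 1 := by
        push_cast; rw [abs_neg, abs_of_nonneg (by positivity)]
      have h2 : |(((M : ℤ) + 1 : ℤ) : ℝ)| = M + 1 := by
        push_cast; rw [abs_of_nonneg (by positivity)]
      rw [h1, h2]
      push_cast
      have h3 : Real.exp (-s * M) = Real.exp s * Real.exp (-s * (M + 1)) := by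
        rw [← Real.exp_add]; congr 1; ring
      rw [h3]
      field_simp
      ring
  rw [key]
  have : 0 < Real.exp (-s * M) := Real.exp_pos _
  have h2 : 2 / (Real.exp s - 1) * (1 - Real.exp (-s * M)) ≤ 2 / (Real.exp s - 1) :=
    mul_le_of_le_one_right (by positivity) (by linarith)
  linarith

/-- Exponential Markov inequality for the counting measure: `‖p‖₁ ≤ √N R` on the ball, so every
point has weight at least `1` under `e^{s(√N R - ‖p‖₁)}`, whose sum factorizes over coordinates. The
parameter `s` is left free: `√N / R` suits general balls, a large constant suits tiny ones. -/
lemma card_latticeBall_le {N : ℕ} {R s : ℝ} (hs : 0 < s) :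
    ((latticeBall N R).card : ℝ)
      ≤ Real.exp (s * √N * R) * (1 + 2 / (Real.exp s - 1)) ^ N := by
  have h1 : ∀ p ∈ latticeBall N R, (1 : ℝ)
      ≤ Real.exp (s * √N * R) * ∏ i, Real.exp (-s * |(p i : ℝ)|) := by
    intro p hp
    have hp := mem_latticeBall.1 hp
    have hR : 0 ≤ R := (norm_nonneg _).trans hp
    rw [← Real.exp_sum, ← Real.exp_add, ← Finset.mul_sum]
    refine Real.one_le_exp ?_
    have h2 : ∑ i, |(p i : ℝ)| ≤ √N * R := by
      have h3 := sq_sum_le_card_mul_sum_sq (s := Finset.univ) (f := fun i => |(p i : ℝ)|)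
      have h4 : ∑ i, |(p i : ℝ)| ^ 2 = ‖intVec p‖ ^ 2 := by
        rw [EuclideanSpace.real_norm_sq_eq]; simp [intVec]
      rw [h4, Finset.card_univ, Fintype.card_fin] at h3
      refine abs_le_of_sq_le_sq (h3.trans ?_) (by positivity) |> le_of_abs_le
      rw [mul_pow, Real.sq_sqrt (by positivity)]
      gcongr
    nlinarith
  calc ((latticeBall N R).card : ℝ) = ∑ p ∈ latticeBall N R, (1 : ℝ) := by simp
    _ ≤ ∑ p ∈ latticeBall N R, Real.exp (s * √N * R) * ∏ i, Real.exp (-s * |(p i : ℝ)|) :=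
        Finset.sum_le_sum h1
    _ ≤ ∑ p ∈ Fintype.piFinset fun _ : Fin N => Finset.Icc (-(⌊R⌋₊ : ℤ)) ⌊R⌋₊,
          Real.exp (s * √N * R) * ∏ i, Real.exp (-s * |(p i : ℝ)|) :=
        Finset.sum_le_sum_of_subset_of_nonneg (Finset.filter_subset _ _)
          fun _ _ _ => by positivity
    _ = Real.exp (s * √N * R)
          * ∏ _i : Fin N, ∑ k ∈ Finset.Icc (-(⌊R⌋₊ : ℤ)) ⌊R⌋₊, Real.exp (-s * |(k : ℝ)|) := by
        rw [← Finset.mul_sum, Finset.prod_univ_sum]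
    _ ≤ Real.exp (s * √N * R) * ∏ _i : Fin N, (1 + 2 / (Real.exp s - 1)) := by
        gcongr with i
        exact sum_exp_neg_abs_le hs _
    _ = _ := by simp

lemma card_latticeBall_le_pow {N : ℕ} (hN : 0 < N) {R : ℝ} (hR : 0 < R) :
    ((latticeBall N R).card : ℝ) ≤ (Real.exp 1 * (1 + 2 * R / √N)) ^ N := by
  have hN' : (0 : ℝ) < √N := by positivity
  have hs : 0 < √N / R := by positivity
  refine (card_latticeBall_le hs).trans ?_
  have h1 : √N / R * √N * R = N := by
    field_simp; rw [Real.sq_sqrt (by positivity)]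
  rw [h1, mul_pow, ← Real.exp_nat_mul, mul_one]
  have h2 : √N / R ≤ Real.exp (√N / R) - 1 := by linarith [Real.add_one_le_exp (√N / R)]
  have h3 : 2 / (Real.exp (√N / R) - 1) ≤ 2 * R / √N := by
    rw [show 2 * R / √N = 2 / (√N / R) by field_simp]
    gcongr
  have : 0 ≤ 2 / (Real.exp (√N / R) - 1) := by
    have : 0 < Real.exp (√N / R) - 1 := hs.trans_le h2
    positivity
  gcongr

/-- Every vector of the unit ball is within `1 / 2` of a lattice point divided by `√N`. -/
lemma exists_lattice_approx {N : ℕ} (x : EuclideanSpace ℝ (Fin N)) (hx : ‖x‖ ≤ 1) :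
    ∃ p ∈ latticeBall N (3 / 2 * √N), ‖x - (√N)⁻¹ • intVec p‖ ≤ 1 / 2 := by
  rcases Nat.eq_zero_or_pos N with rfl | hN
  · refine ⟨0, mem_latticeBall.2 ?_, ?_⟩
    · rw [Subsingleton.elim (intVec _) 0]; simp
    · rw [Subsingleton.elim (x - _) 0]; simp
  have hN' : (0 : ℝ) < √N := by positivity
  let p : Fin N → ℤ := fun i => round (√N * x i)
  have h1 : ‖√N • x - intVec p‖ ≤ √N / 2 := by
    refine abs_le_of_sq_le_sq ?_ (by positivity) |> le_of_abs_le
    rw [EuclideanSpace.real_norm_sq_eq]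
    calc ∑ i, ((√N • x - intVec p) i) ^ 2 ≤ ∑ _i : Fin N, ((1 : ℝ) / 2) ^ 2 := by
          refine Finset.sum_le_sum fun i _ => ?_
          have := abs_sub_round (√N * x i)
          simp only [PiLp.sub_apply, PiLp.smul_apply, smul_eq_mul, intVec, p]
          exact sq_le_sq' (by linarith [(abs_le.1 this).1]) (abs_le.1 this).2
      _ = (√N / 2) ^ 2 := by
          rw [div_pow √(N : ℝ) 2, Real.sq_sqrt (by positivity)]; simp; ring
  refine ⟨p, mem_latticeBall.2 ?_, ?_⟩
  · have h2 : ‖intVec p‖ ≤ ‖√N • x‖ + ‖√N • x - intVec p‖ := by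
      rw [norm_sub_rev]; exact norm_le_norm_add_norm_sub' _ _
    rw [norm_smul, Real.norm_of_nonneg hN'.le] at h2
    nlinarith
  · have h2 : x - (√N)⁻¹ • intVec p = (√N)⁻¹ • (√N • x - intVec p) := by
      rw [smul_sub, smul_smul, inv_mul_cancel₀ hN'.ne', one_smul]
    rw [h2, norm_smul, norm_inv, Real.norm_of_nonneg hN'.le, inv_mul_le_iff₀ hN']
    linarith

/-- Net argument: a unit vector is within `1 / 2` of a net point, so `‖A‖ ≤ C + ‖A‖ / 2`. -/
lemma opNorm_le_of_lattice {n N : ℕ} {A : Fin n → Fin N → ℝ} {C : ℝ} (hC : 0 ≤ C)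
    (h : ∀ p ∈ latticeBall N (3 / 2 * √N), ‖matMap A ((√N)⁻¹ • intVec p)‖ ≤ C) :
    ‖matMap A‖ ≤ 2 * C := by
  have h1 : ∀ x : EuclideanSpace ℝ (Fin N), ‖x‖ = 1 → ‖matMap A x‖ ≤ C + ‖matMap A‖ / 2 := by
    intro x hx
    obtain ⟨p, hp, hd⟩ := exists_lattice_approx x hx.le
    calc ‖matMap A x‖ = ‖matMap A ((√N)⁻¹ • intVec p) + matMap A (x - (√N)⁻¹ • intVec p)‖ := by
          rw [← map_add]; congr 2; abel
      _ ≤ C + ‖matMap A‖ * (1 / 2) := by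
          refine (norm_add_le _ _).trans (add_le_add (h p hp) ?_)
          exact ((matMap A).le_opNorm _).trans (by gcongr)
      _ = _ := by ring
  have h2 : ‖matMap A‖ ≤ C + ‖matMap A‖ / 2 := by
    refine ContinuousLinearMap.opNorm_le_of_unit_norm (by positivity) h1
  linarith

lemma matLaw_opNorm_le {ν : Measure ℝ} [IsProbabilityMeasure ν] {lam : ℝ}
    (h : IsStdSubgaussian ν lam) {n N : ℕ} (hn : n ≤ N) :
    matLaw ν n N {A | 2 * √(180 / lam) * √N < ‖matMap A‖} ≤ ENNReal.ofReal (Real.exp (-N)) := by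
  have hl := h.lam_pos
  rcases Nat.eq_zero_or_pos N with rfl | hN
  · simp only [CharP.cast_eq_zero, neg_zero, Real.exp_zero, ENNReal.ofReal_one]
    exact prob_le_one
  have hN' : (0 : ℝ) < √N := by positivity
  set T := latticeBall N (3 / 2 * √N)
  have hmain : matLaw ν n N {A | 2 * √(180 / lam) * √N < ‖matMap A‖}
      ≤ ENNReal.ofReal (T.card * (Real.exp (-(5 * N)) * 2 ^ n)) := by
    -- Net points have norm at most `3 / 2`, so `lam / 36` is the largest exponent allowed by
    -- `lintegral_exp_sq_rowDot_le`. With `180 = 5 * 36` the Markov factor is `e^{-5N}`, which beats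
    -- `(4e)^N 2^n`.
    refine matLaw_le_card_mul (κ := -(lam / 36)) T (fun p => (√N)⁻¹ • intVec p) (fun p hp => ?_)
      (by norm_num) fun A hA => ?_
    · have hp' : ‖(√N)⁻¹ • intVec p‖ ≤ 3 / 2 := by
        rw [norm_smul, norm_inv, Real.norm_of_nonneg hN'.le, inv_mul_le_iff₀ hN']
        linarith [mem_latticeBall.1 hp]
      have := lintegral_exp_sq_rowDot_le h (y := (√N)⁻¹ • intVec p) (τ := lam / 36)
        (by positivity)
        (by nlinarith [norm_nonneg ((√N)⁻¹ • intVec p), pow_le_pow_left₀ (norm_nonneg _) hp' 2])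
      simpa using this
    · by_contra! hc
      refine absurd (opNorm_le_of_lattice (A := A) (C := √(180 / lam) * √N) (by positivity) ?_)
        (by rw [not_le, ← mul_assoc]; exact hA)
      intro p hp
      have h1 := hc p hp
      rw [← norm_matMap_sq] at h1
      refine abs_le_of_sq_le_sq ?_ (by positivity) |> le_of_abs_le
      rw [mul_pow, Real.sq_sqrt (by positivity), Real.sq_sqrt (by positivity),
        div_mul_eq_mul_div, le_div_iff₀ hl]
      linarith
  have hcard : (T.card : ℝ) ≤ (Real.exp 1 * 4) ^ N := by
    have := card_latticeBall_le_pow hN (R := 3 / 2 * √N) (by positivity)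
    rwa [show 1 + 2 * (3 / 2 * √N) / √N = 4 by field_simp; norm_num] at this
  refine hmain.trans ?_
  refine ENNReal.ofReal_le_ofReal ?_
  calc T.card * (Real.exp (-(5 * N)) * 2 ^ n)
      ≤ (Real.exp 1 * 4) ^ N * (Real.exp (-(5 * N)) * 2 ^ N) := by
        gcongr; norm_num
    _ = (8 * Real.exp (-4)) ^ N := by
        rw [show Real.exp (-(5 * N)) = Real.exp (-5) ^ N by
          rw [← Real.exp_nat_mul]; congr 1; ring, ← mul_pow, ← mul_pow]
        congr 1
        rw [show (-4 : ℝ) = 1 + -5 by norm_num, Real.exp_add]; ring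
    _ ≤ Real.exp (-1) ^ N := by
        gcongr
        rw [show (-1 : ℝ) = 3 + -4 by norm_num, Real.exp_add]
        gcongr
        rw [show (3 : ℝ) = (3 : ℕ) * 1 by norm_num, Real.exp_nat_mul]
        have := Real.exp_one_gt_d9
        calc (8 : ℝ) = 2 ^ 3 := by norm_num
          _ ≤ _ := by gcongr; linarith
    _ = _ := by rw [← Real.exp_nat_mul]; congr 1; ring

/-! ### Distance to the lattice. -/

/-- The Euclidean distance to the integer points. -/
def latDist {N : ℕ} (u : EuclideanSpace ℝ (Fin N)) : ℝ := Metric.infDist u (integerPoints N)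

section LatDist

variable {N : ℕ}

lemma zero_mem_integerPoints : (0 : EuclideanSpace ℝ (Fin N)) ∈ integerPoints N :=
  fun _ => ⟨0, by simp⟩

lemma latDist_nonneg (u : EuclideanSpace ℝ (Fin N)) : 0 ≤ latDist u := Metric.infDist_nonneg

lemma continuous_latDist : Continuous (latDist (N := N)) := Metric.continuous_infDist_pt _

lemma latDist_le_norm_sub (u : EuclideanSpace ℝ (Fin N)) (p : Fin N → ℤ) :
    latDist u ≤ ‖u - intVec p‖ := by
  rw [← dist_eq_norm]; exact Metric.infDist_le_dist_of_mem (intVec_mem p)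

lemma exists_of_latDist_lt {u : EuclideanSpace ℝ (Fin N)} {r : ℝ} (h : latDist u < r) :
    ∃ p, ‖u - intVec p‖ < r := by
  obtain ⟨z, hz, hd⟩ := (Metric.infDist_lt_iff ⟨0, zero_mem_integerPoints⟩).1 h
  obtain ⟨p, rfl⟩ := exists_intVec_eq hz
  exact ⟨p, by rwa [← dist_eq_norm]⟩

lemma latDist_sub_le (u v : EuclideanSpace ℝ (Fin N)) :
    latDist (u - v) ≤ latDist u + latDist v := by
  refine le_of_forall_pos_lt_add fun ε hε => ?_
  obtain ⟨p, hp⟩ := exists_of_latDist_lt (show latDist u < latDist u + ε / 2 by linarith)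
  obtain ⟨q, hq⟩ := exists_of_latDist_lt (show latDist v < latDist v + ε / 2 by linarith)
  have h1 : u - v - intVec (p - q) = (u - intVec p) - (v - intVec q) := by
    have : intVec (p - q) = intVec p - intVec q := by ext i; simp [intVec]
    rw [this]; abel
  have h2 := latDist_le_norm_sub (u - v) (p - q)
  rw [h1] at h2
  linarith [norm_sub_le (u - intVec p) (v - intVec q)]

lemma latDist_neg (u : EuclideanSpace ℝ (Fin N)) : latDist (-u) = latDist u := by
  have h0 : latDist (0 : EuclideanSpace ℝ (Fin N)) = 0 :=
    Metric.infDist_zero_of_mem zero_mem_integerPoints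
  have h : ∀ w : EuclideanSpace ℝ (Fin N), latDist (-w) ≤ latDist w := fun w => by
    simpa [h0] using latDist_sub_le 0 w
  exact le_antisymm (h u) (by simpa using h (-u))

/-- Apply `cos x ≤ 1 - 2x²/π²` on `[-π, π]` after reducing each coordinate modulo the nearest
integer. -/
lemma latDist_sq_le (u : EuclideanSpace ℝ (Fin N)) :
    8 * latDist u ^ 2 ≤ ∑ j, (1 - Real.cos (2 * Real.pi * u j)) := by
  have h1 : latDist u ^ 2 ≤ ∑ j, (u j - round (u j)) ^ 2 := by
    have := pow_le_pow_left₀ (latDist_nonneg u)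
      (latDist_le_norm_sub u fun j => round (u j)) 2
    rw [EuclideanSpace.real_norm_sq_eq] at this
    simpa [intVec] using this
  refine (mul_le_mul_of_nonneg_left h1 (by norm_num)).trans ?_
  rw [Finset.mul_sum]
  refine Finset.sum_le_sum fun j _ => ?_
  have h2 := abs_sub_round (u j)
  have h3 : Real.cos (2 * Real.pi * u j) = Real.cos (2 * Real.pi * (u j - round (u j))) := by
    rw [mul_sub, mul_comm (2 * Real.pi) (round (u j) : ℝ), Real.cos_sub_int_mul_two_pi]
  rw [h3]
  have hpi := Real.pi_pos
  have h4 : |2 * Real.pi * (u j - round (u j))| ≤ Real.pi := by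
    rw [abs_mul, abs_of_pos (by positivity)]; nlinarith
  have h5 := Real.cos_le_one_sub_mul_cos_sq h4
  have h6 : 2 / Real.pi ^ 2 * (2 * Real.pi * (u j - round (u j))) ^ 2
      = 8 * (u j - round (u j)) ^ 2 := by field_simp; ring
  linarith

end LatDist

/-! ### Characteristic functions and the small ball estimate. -/

/-- Window averages control the Gaussian average: for `|g - a| ≤ 1` the density at `g` is at most `ψ
a`, a wider Gaussian of total mass `√(2e) ≤ 3`, so Fubini over the pairs `(g, a)` with `|g - a| ≤ l`
gives the claim. -/
lemma ofReal_two_mul_lintegral_gaussian_le {G : ℝ → ENNReal} (hG : Measurable G) {l : ℝ}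
    (hl : 0 < l) (hl1 : l ≤ 1) {M : ENNReal}
    (h : ∀ a, ∫⁻ g in Set.Icc (a - l) (a + l), G g ≤ ENNReal.ofReal (2 * l) * M) :
    ∫⁻ g, G g ∂(gaussianReal 0 1) ≤ 3 * M := by
  set ψ : ℝ → ENNReal := fun a => ENNReal.ofReal
    ((√(2 * Real.pi))⁻¹ * Real.exp (1 / 2) * Real.exp (-(1 / 4) * a ^ 2)) with hψ
  have hψm : Measurable ψ := by fun_prop
  have hψi : ∫⁻ a, ψ a ≤ 3 := by
    have h1 : ∀ a, ψ a = ENNReal.ofReal ((√(2 * Real.pi))⁻¹ * Real.exp (1 / 2))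
        * ENNReal.ofReal (Real.exp (-(1 / 4) * a ^ 2)) := fun a => by
      rw [hψ, ← ENNReal.ofReal_mul (by positivity)]
    simp_rw [h1]
    rw [lintegral_const_mul _ (by fun_prop), lintegral_exp_neg_mul_sq (by norm_num),
      ← ENNReal.ofReal_mul (by positivity)]
    refine (ENNReal.ofReal_le_ofReal (q := 3) ?_).trans (by simp)
    have h2 : Real.pi / (1 / 4) = 2 * (2 * Real.pi) := by ring
    rw [h2, Real.sqrt_mul (by norm_num) (2 * Real.pi)]
    have h3 : (√(2 * Real.pi))⁻¹ * Real.exp (1 / 2) * (√2 * √(2 * Real.pi))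
        = √2 * Real.exp (1 / 2) := by
      have : √(2 * Real.pi) ≠ 0 := by positivity
      field_simp
    rw [h3]
    refine abs_le_of_sq_le_sq ?_ (by norm_num) |> le_of_abs_le
    rw [mul_pow, Real.sq_sqrt (by norm_num), ← Real.exp_nat_mul]
    have := Real.exp_one_lt_d9
    norm_num
    linarith
  set K : ℝ × ℝ → ENNReal := fun q =>
    Set.indicator {q : ℝ × ℝ | |q.1 - q.2| ≤ l} (fun q => ψ q.2 * G q.1) q with hK
  have hset : MeasurableSet {q : ℝ × ℝ | |q.1 - q.2| ≤ l} :=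
    (isClosed_le (by fun_prop) (by fun_prop)).measurableSet
  have hKm : Measurable K := Measurable.indicator (by fun_prop) hset
  have hl0 : ENNReal.ofReal (2 * l) ≠ 0 := by simpa using hl
  have hmain : ENNReal.ofReal (2 * l) * ∫⁻ g, G g ∂(gaussianReal 0 1)
      ≤ ENNReal.ofReal (2 * l) * (3 * M) := by
    rw [lintegral_gaussianReal hG, ← lintegral_const_mul _ (by fun_prop)]
    calc _ ≤ ∫⁻ g, ∫⁻ a, K (g, a) := by
          refine lintegral_mono fun g => ?_
          have h1 : ∀ a, (Set.Icc (g - l) (g + l)).indicator (fun _ => ENNReal.ofReal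
              ((√(2 * Real.pi))⁻¹ * Real.exp (-g ^ 2 / 2)) * G g) a ≤ K (g, a) := by
            intro a
            by_cases hga : |g - a| ≤ l
            · have hmem : (g, a) ∈ {q : ℝ × ℝ | |q.1 - q.2| ≤ l} := hga
              simp only [hK]
              rw [Set.indicator_of_mem hmem]
              refine (Set.indicator_le_self _ _ _).trans (mul_le_mul_left ?_ _)
              refine ENNReal.ofReal_le_ofReal ?_
              rw [mul_assoc, ← Real.exp_add]
              gcongr
              have h4 := abs_le.1 (hga.trans hl1)
              nlinarith [sq_nonneg (2 * g - a), mul_nonneg (sub_nonneg.2 h4.2)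
                (by linarith [h4.1] : 0 ≤ g - a + 1)]
            · rw [Set.indicator_of_notMem]
              · exact zero_le
              · rw [Set.mem_Icc]
                intro hc
                exact hga (abs_le.2 ⟨by linarith [hc.2], by linarith [hc.1]⟩)
          refine le_trans (le_of_eq ?_) (lintegral_mono h1)
          rw [lintegral_indicator measurableSet_Icc, setLIntegral_const, Real.volume_Icc, mul_comm]
          congr 2; ring
      _ = ∫⁻ a, ∫⁻ g, K (g, a) := lintegral_lintegral_swap hKm.aemeasurable
      _ ≤ ∫⁻ a, ψ a * (ENNReal.ofReal (2 * l) * M) := by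
          refine lintegral_mono fun a => ?_
          refine le_trans (le_of_eq ?_) (mul_le_mul_right (h a) (ψ a))
          rw [← lintegral_const_mul _ hG, ← lintegral_indicator measurableSet_Icc]
          refine lintegral_congr fun g => ?_
          simp only [hK, Set.indicator, Set.mem_ofPred_eq, Set.mem_Icc, abs_le]
          congr 1
          apply propext
          constructor <;> rintro ⟨h1, h2⟩ <;> constructor <;> linarith
      _ = (∫⁻ a, ψ a) * (ENNReal.ofReal (2 * l) * M) := lintegral_mul_const _ hψm
      _ ≤ 3 * (ENNReal.ofReal (2 * l) * M) := by gcongr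
      _ = _ := by ring
  exact (ENNReal.mul_le_mul_iff_right hl0 ENNReal.ofReal_ne_top).1 hmain

section CharFun

variable {ν : Measure ℝ} [IsProbabilityMeasure ν] {N : ℕ}

/-- Symmetrization: `|φ|²` is the characteristic function of the difference of two independent
copies. -/
lemma norm_charFun_sq (s : ℝ) :
    ‖charFun ν s‖ ^ 2 = ∫ z, Real.cos (s * (z.1 - z.2)) ∂(ν.prod ν) := by
  have h1 : ((‖charFun ν s‖ ^ 2 : ℝ) : ℂ)
      = ∫ z, Complex.exp (s * (z.1 - z.2) * Complex.I) ∂(ν.prod ν) := by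
    rw [Complex.ofReal_pow, ← Complex.mul_conj', ← charFun_neg, charFun_apply_real, charFun_apply_real,
      ← integral_prod_mul]
    refine integral_congr_ae (ae_of_all _ fun z => ?_)
    simp only
    rw [← Complex.exp_add]
    push_cast
    congr 1; ring
  have h2 := congrArg Complex.re h1
  have hi : Integrable (fun z : ℝ × ℝ => Complex.exp (s * (z.1 - z.2) * Complex.I))
      (ν.prod ν) := by
    refine (integrable_const (1 : ℝ)).mono' (by fun_prop) (ae_of_all _ fun z => ?_)
    rw [show (s * (z.1 - z.2) * Complex.I : ℂ) = ((s * (z.1 - z.2) : ℝ) : ℂ) * Complex.I by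
      push_cast; ring, Complex.norm_exp_ofReal_mul_I]
  rw [Complex.ofReal_re] at h2
  rw [h2, ← RCLike.re_eq_complex_re, ← integral_re hi]
  refine integral_congr_ae (ae_of_all _ fun z => ?_)
  simp only [RCLike.re_eq_complex_re]
  rw [show (s * (z.1 - z.2) * Complex.I : ℂ) = ((s * (z.1 - z.2) : ℝ) : ℂ) * Complex.I by
    push_cast; ring, Complex.exp_ofReal_mul_I_re]

lemma norm_charFun_le_exp (s : ℝ) :
    ‖charFun ν s‖ ≤ Real.exp (-(1 / 2) * ∫ z, (1 - Real.cos (s * (z.1 - z.2))) ∂(ν.prod ν)) := by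
  have hi : Integrable (fun z : ℝ × ℝ => Real.cos (s * (z.1 - z.2))) (ν.prod ν) := by
    refine (integrable_const (1 : ℝ)).mono' (by fun_prop) (ae_of_all _ fun z => ?_)
    exact Real.abs_cos_le_one _
  rw [integral_sub (integrable_const _) hi, ← norm_charFun_sq]
  refine abs_le_of_sq_le_sq ?_ (Real.exp_pos _).le |> le_of_abs_le
  rw [← Real.exp_nat_mul]
  have := Real.add_one_le_exp (‖charFun ν s‖ ^ 2 - 1)
  simp only [integral_const, probReal_univ, smul_eq_mul, mul_one]
  refine le_trans (by linarith) (this.trans (le_of_eq ?_))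
  congr 1; push_cast; ring

lemma integral_cexp_rowDot (y : EuclideanSpace ℝ (Fin N)) (b : ℝ) :
    ∫ v, Complex.exp (b * rowDot y v * Complex.I) ∂rowLaw ν N = ∏ j, charFun ν (b * y j) := by
  have h1 : ∀ v : Fin N → ℝ, Complex.exp (b * rowDot y v * Complex.I)
      = ∏ j, Complex.exp ((b * y j : ℝ) * v j * Complex.I) := by
    intro v
    rw [← Complex.exp_sum, rowDot]
    congr 1
    push_cast
    rw [Finset.mul_sum, Finset.sum_mul]
    exact Finset.sum_congr rfl fun j _ => by ring
  simp_rw [h1]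
  rw [integral_fintype_prod_eq_prod (μ := fun _ : Fin N => ν)
    (f := fun j (x : ℝ) => Complex.exp ((b * y j : ℝ) * (x : ℂ) * Complex.I))]
  simp_rw [charFun_apply_real]

lemma integrable_latDist_sq {N : ℕ} {X : Type*} [MeasurableSpace X] (η : Measure X)
    [IsFiniteMeasure η] {f : X → EuclideanSpace ℝ (Fin N)} (hf : Measurable f) :
    Integrable (fun z => latDist (f z) ^ 2) η := by
  refine (integrable_const (N : ℝ)).mono'
    ((continuous_latDist.measurable.comp hf).pow_const 2).aestronglyMeasurable
    (ae_of_all _ fun z => ?_)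
  rw [Real.norm_of_nonneg (sq_nonneg _)]
  have h1 := latDist_sq_le (f z)
  have h2 : ∑ j, (1 - Real.cos (2 * Real.pi * f z j)) ≤ ∑ _j : Fin N, (2 : ℝ) :=
    Finset.sum_le_sum fun j _ => by linarith [Real.neg_one_le_cos (2 * Real.pi * f z j)]
  simp only [Finset.sum_const, Finset.card_univ, Fintype.card_fin, nsmul_eq_mul] at h2
  have : (0 : ℝ) ≤ N := Nat.cast_nonneg N
  linarith

/-- The product over coordinates turns into a sum of terms `1 - cos` in the exponent, and
`latDist_sq_le` bounds that sum below by a squared distance to the lattice. -/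
lemma norm_integral_cexp_rowDot_le (y : EuclideanSpace ℝ (Fin N)) (b : ℝ) :
    ‖∫ v, Complex.exp (b * rowDot y v * Complex.I) ∂rowLaw ν N‖
      ≤ Real.exp (-4 * ∫ z, latDist ((b * (z.1 - z.2) / (2 * Real.pi)) • y) ^ 2 ∂(ν.prod ν)) := by
  rw [integral_cexp_rowDot, norm_prod]
  calc ∏ j, ‖charFun ν (b * y j)‖
      ≤ ∏ j, Real.exp (-(1 / 2) * ∫ z, (1 - Real.cos (b * y j * (z.1 - z.2))) ∂(ν.prod ν)) :=
        Finset.prod_le_prod (fun _ _ => norm_nonneg _) fun j _ => norm_charFun_le_exp _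
    _ = Real.exp (-(1 / 2) * ∫ z, ∑ j, (1 - Real.cos (b * y j * (z.1 - z.2))) ∂(ν.prod ν)) := by
        rw [← Real.exp_sum, ← Finset.mul_sum, integral_finsetSum]
        intro j _
        refine (integrable_const (2 : ℝ)).mono' (by fun_prop) (ae_of_all _ fun z => ?_)
        have h1 := Real.neg_one_le_cos (b * y j * (z.1 - z.2))
        have h2 := Real.cos_le_one (b * y j * (z.1 - z.2))
        rw [Real.norm_of_nonneg (by linarith)]
        linarith
    _ ≤ _ := by
        rw [Real.exp_le_exp]
        have h1 : ∫ z, 8 * latDist ((b * (z.1 - z.2) / (2 * Real.pi)) • y) ^ 2 ∂(ν.prod ν)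
            ≤ ∫ z, ∑ j, (1 - Real.cos (b * y j * (z.1 - z.2))) ∂(ν.prod ν) := by
          refine integral_mono ((integrable_latDist_sq _ (by fun_prop)).const_mul 8) ?_ fun z => ?_
          · refine (integrable_const (2 * N : ℝ)).mono' (by fun_prop) (ae_of_all _ fun z => ?_)
            rw [Real.norm_of_nonneg
              (Finset.sum_nonneg fun j _ => sub_nonneg.2 (Real.cos_le_one _))]
            have h2 : ∑ j, (1 - Real.cos (b * y j * (z.1 - z.2))) ≤ ∑ _j : Fin N, (2 : ℝ) :=
              Finset.sum_le_sum fun j _ => by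
                linarith [Real.neg_one_le_cos (b * y j * (z.1 - z.2))]
            simpa [mul_comm] using h2
          · refine (latDist_sq_le _).trans (le_of_eq ?_)
            refine Finset.sum_congr rfl fun j _ => ?_
            simp only [PiLp.smul_apply, smul_eq_mul]
            congr 2
            field_simp
        rw [integral_const_mul] at h1
        linarith

/-- `e^{-κX²}` is the Gaussian characteristic function at `√(2κ) X`; exchange the two integrals and
take absolute values inside. -/
lemma integral_exp_neg_sq_le_integral_norm (y : EuclideanSpace ℝ (Fin N)) {κ : ℝ} (hκ : 0 ≤ κ) :
    ∫ v, Real.exp (-κ * rowDot y v ^ 2) ∂rowLaw ν N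
      ≤ ∫ g, ‖∫ v, Complex.exp ((√(2 * κ) * g : ℝ) * rowDot y v * Complex.I) ∂rowLaw ν N‖
        ∂(gaussianReal 0 1) := by
  have h1 : ((∫ v, Real.exp (-κ * rowDot y v ^ 2) ∂rowLaw ν N : ℝ) : ℂ)
      = ∫ g, ∫ v, Complex.exp ((√(2 * κ) * g : ℝ) * rowDot y v * Complex.I) ∂rowLaw ν N
        ∂(gaussianReal 0 1) := by
    rw [← integral_complex_ofReal, ← integral_integral_swap]
    · refine integral_congr_ae (ae_of_all _ fun v => ?_)
      have h2 := charFun_gaussianReal (μ := 0) (v := 1) (√(2 * κ) * rowDot y v)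
      rw [charFun_apply_real] at h2
      simp only
      have h3 : ∀ x : ℝ, Complex.exp ((√(2 * κ) * x : ℝ) * rowDot y v * Complex.I)
          = Complex.exp ((√(2 * κ) * rowDot y v : ℝ) * x * Complex.I) := fun x => by
        congr 1; push_cast; ring
      simp_rw [h3]
      rw [h2]
      have h4 : ((√(2 * κ) : ℝ) : ℂ) ^ 2 = 2 * κ := by
        rw [← Complex.ofReal_pow, Real.sq_sqrt (by positivity)]; push_cast; rfl
      push_cast
      congr 1
      rw [mul_pow, h4]
      ring
    · refine (integrable_const (1 : ℝ)).mono' (by fun_prop) (ae_of_all _ fun z => ?_)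
      simp only [Function.uncurry]
      rw [← Complex.ofReal_mul, Complex.norm_exp_ofReal_mul_I]
  calc _ = ‖((∫ v, Real.exp (-κ * rowDot y v ^ 2) ∂rowLaw ν N : ℝ) : ℂ)‖ := by
        rw [Complex.norm_real, Real.norm_of_nonneg]
        exact integral_nonneg fun _ => (Real.exp_pos _).le
    _ ≤ _ := by rw [h1]; exact norm_integral_le_integral_norm _

end CharFun

section SmallBall

variable {N : ℕ}

/-- No multiple `θ • y` with `0 < θ < D` is close to the integer points. -/
def FarFromLattice (γ α D : ℝ) (y : EuclideanSpace ℝ (Fin N)) : Prop :=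
  ∀ θ, 0 < θ → θ < D → min (γ * θ) α ≤ latDist (θ • y)

/-- If both `a • y` and `b • y` are close to the lattice, so is their difference, which is a small
multiple of `y`. -/
lemma FarFromLattice.min_le_two_mul {γ α D : ℝ} {y : EuclideanSpace ℝ (Fin N)}
    (h : FarFromLattice γ α D y) (hα : 0 ≤ α) {a b : ℝ} (hab : |a - b| < D)
    (hle : latDist (b • y) ≤ latDist (a • y)) :
    min (γ * |a - b|) α ≤ 2 * latDist (a • y) := by
  have h1 : latDist ((a - b) • y) ≤ 2 * latDist (a • y) := by
    rw [sub_smul]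
    linarith [latDist_sub_le (a • y) (b • y)]
  refine le_trans ?_ h1
  rcases eq_or_ne a b with rfl | hne
  · simp [hα, latDist_nonneg]
  · refine (h _ (abs_pos.2 (sub_ne_zero.2 hne)) hab).trans (le_of_eq ?_)
    rcases abs_choice (a - b) with h2 | h2 <;> rw [h2]
    rw [neg_smul, latDist_neg]

/-- In each window, compare with the minimizer `g₀` of the distance: the integrand is at most a
Gaussian bump around `g₀` plus the constant `e^{-pα²}`. The half-length `r / W` makes the averaged
bump independent of `W`, hence the bound uniform in the increment of the symmetrized variable. -/
lemma FarFromLattice.lintegral_gaussian_le {γ α D : ℝ} {y : EuclideanSpace ℝ (Fin N)}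
    (h : FarFromLattice γ α D y) (hγ : 0 < γ) (hα : 0 ≤ α) {r W p : ℝ} (hr : 0 < r)
    (hrD : 2 * r < D) (hrW : r ≤ W) (hp : 0 < p) :
    ∫⁻ g, ENNReal.ofReal (Real.exp (-4 * p * latDist ((W * g) • y) ^ 2)) ∂(gaussianReal 0 1)
      ≤ 3 * ENNReal.ofReal (√(Real.pi / p) / (2 * r * γ) + Real.exp (-p * α ^ 2)) := by
  have hW : 0 < W := hr.trans_le hrW
  have hc : Continuous fun g : ℝ => latDist ((W * g) • y) :=
    continuous_latDist.comp (by fun_prop)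
  refine ofReal_two_mul_lintegral_gaussian_le (l := r / W)
    (by have := hc.measurable; fun_prop) (by positivity) ((div_le_one hW).2 hrW) fun a => ?_
  have hl : 0 < r / W := by positivity
  obtain ⟨g₀, hg₀, hmin⟩ := (isCompact_Icc (a := a - r / W) (b := a + r / W)).exists_isMinOn
    ⟨a, by constructor <;> linarith⟩ hc.continuousOn
  have hb : 0 < p * (γ * W) ^ 2 := by positivity
  calc ∫⁻ g in Set.Icc (a - r / W) (a + r / W),
        ENNReal.ofReal (Real.exp (-4 * p * latDist ((W * g) • y) ^ 2))
      ≤ ∫⁻ g in Set.Icc (a - r / W) (a + r / W),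
        (ENNReal.ofReal (Real.exp (-(p * (γ * W) ^ 2) * (g - g₀) ^ 2))
          + ENNReal.ofReal (Real.exp (-p * α ^ 2))) := by
        refine setLIntegral_mono (by fun_prop) fun g hg => ?_
        rw [← ENNReal.ofReal_add (Real.exp_pos _).le (Real.exp_pos _).le]
        refine ENNReal.ofReal_le_ofReal ?_
        have h0 : |g - g₀| ≤ 2 * (r / W) := by
          rw [abs_le]; constructor <;> linarith [hg.1, hg.2, hg₀.1, hg₀.2]
        have h0' : |W * g - W * g₀| = W * |g - g₀| := by
          rw [← mul_sub, abs_mul, abs_of_pos hW]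
        have h1 := h.min_le_two_mul hα (a := W * g) (b := W * g₀) (by
          rw [h0']
          refine lt_of_le_of_lt (mul_le_mul_of_nonneg_left h0 hW.le) ?_
          rw [show W * (2 * (r / W)) = 2 * r by field_simp]
          exact hrD) (hmin hg)
        rw [h0'] at h1
        set d := latDist ((W * g) • y)
        rcases min_le_iff.1 h1 with h2 | h2
        · have h3 : (γ * W) ^ 2 * (g - g₀) ^ 2 ≤ 4 * d ^ 2 := by
            have := pow_le_pow_left₀ (by positivity) h2 2
            rw [mul_pow, mul_pow, sq_abs] at this
            linarith [this]
          have h4 : Real.exp (-4 * p * d ^ 2)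
              ≤ Real.exp (-(p * (γ * W) ^ 2) * (g - g₀) ^ 2) := by
            rw [Real.exp_le_exp]; nlinarith
          linarith [Real.exp_pos (-p * α ^ 2)]
        · have h3 : α ^ 2 ≤ 4 * d ^ 2 := by
            have := pow_le_pow_left₀ hα h2 2
            linarith
          have h4 : Real.exp (-4 * p * d ^ 2) ≤ Real.exp (-p * α ^ 2) := by
            rw [Real.exp_le_exp]; nlinarith
          linarith [Real.exp_pos (-(p * (γ * W) ^ 2) * (g - g₀) ^ 2)]
    _ = (∫⁻ g in Set.Icc (a - r / W) (a + r / W),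
          ENNReal.ofReal (Real.exp (-(p * (γ * W) ^ 2) * (g - g₀) ^ 2)))
        + ENNReal.ofReal (Real.exp (-p * α ^ 2)) * ENNReal.ofReal (2 * (r / W)) := by
        rw [lintegral_add_right _ measurable_const, setLIntegral_const, Real.volume_Icc]
        congr 3; ring
    _ ≤ (∫⁻ g, ENNReal.ofReal (Real.exp (-(p * (γ * W) ^ 2) * (g - g₀) ^ 2)))
        + ENNReal.ofReal (Real.exp (-p * α ^ 2)) * ENNReal.ofReal (2 * (r / W)) := by
        gcongr
        exact Measure.restrict_le_self
    _ = ENNReal.ofReal √(Real.pi / (p * (γ * W) ^ 2))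
        + ENNReal.ofReal (Real.exp (-p * α ^ 2)) * ENNReal.ofReal (2 * (r / W)) := by
        rw [← lintegral_exp_neg_mul_sq hb]
        congr 1
        exact lintegral_sub_right_eq_self
          (fun g : ℝ => ENNReal.ofReal (Real.exp (-(p * (γ * W) ^ 2) * g ^ 2))) g₀
    _ = _ := by
        rw [← ENNReal.ofReal_mul (Real.exp_pos _).le, ← ENNReal.ofReal_mul (by positivity),
          ← ENNReal.ofReal_add (by positivity) (by positivity)]
        congr 1
        rw [← div_div, Real.sqrt_div' _ (by positivity), Real.sqrt_sq (by positivity)]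
        field_simp

end SmallBall

/-- A Paley–Zygmund argument: the difference has second moment `2` and fourth moment at most `K = 96
/ lam ^ 2`, so it cannot be below `1` too often. -/
lemma IsStdSubgaussian.measure_one_le_abs_sub {ν : Measure ℝ} [IsProbabilityMeasure ν] {lam : ℝ}
    (h : IsStdSubgaussian ν lam) :
    lam ^ 2 / 96 ≤ (ν.prod ν).real {z | 1 ≤ |z.1 - z.2|} := by
  have hl := h.lam_pos
  set I : Set (ℝ × ℝ) := {z | 1 ≤ |z.1 - z.2|}
  have hI : MeasurableSet I := (isClosed_le (by fun_prop) (by fun_prop)).measurableSet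
  set K : ℝ := 96 / lam ^ 2 with hK
  have hK0 : 0 < K := by positivity
  have i4 : Integrable (fun z : ℝ × ℝ => 8 * (z.1 ^ 4 + z.2 ^ 4)) (ν.prod ν) :=
    ((h.integrable_pow_four.comp_fst ν).add (h.integrable_pow_four.comp_snd ν)).const_mul 8
  have i2a := h.integrable_sq.comp_fst ν
  have i2b := h.integrable_sq.comp_snd ν
  have i11 : Integrable (fun z : ℝ × ℝ => z.1 * z.2) (ν.prod ν) :=
    h.integrable_id.mul_prod h.integrable_id
  have e2 : ∫ z : ℝ × ℝ, (z.1 - z.2) ^ 2 ∂(ν.prod ν) = 2 := by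
    have h1 : ∀ z : ℝ × ℝ, (z.1 - z.2) ^ 2 = (z.1 ^ 2 + z.2 ^ 2) - 2 * (z.1 * z.2) := fun z => by
      ring
    have i2 : Integrable (fun z : ℝ × ℝ => z.1 ^ 2 + z.2 ^ 2) (ν.prod ν) := i2a.add i2b
    simp_rw [h1]
    rw [integral_sub i2 (i11.const_mul 2), integral_add i2a i2b,
      integral_const_mul, integral_prod_mul (fun x : ℝ => x) (fun x : ℝ => x), h.mean,
      integral_fun_fst (fun x : ℝ => x ^ 2), integral_fun_snd (fun x : ℝ => x ^ 2), h.second]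
    simp; norm_num
  have e4 : ∫ z : ℝ × ℝ, 8 * (z.1 ^ 4 + z.2 ^ 4) ∂(ν.prod ν) ≤ K := by
    rw [integral_const_mul, integral_add (h.integrable_pow_four.comp_fst ν)
      (h.integrable_pow_four.comp_snd ν), integral_fun_fst (fun x : ℝ => x ^ 4),
      integral_fun_snd (fun x : ℝ => x ^ 4)]
    simp only [probReal_univ, one_smul]
    have := h.integral_pow_four_le
    have h6 : K = 16 * (6 / lam ^ 2) := by rw [hK]; ring
    linarith
  have iI : Integrable (I.indicator fun _ => (1 : ℝ)) (ν.prod ν) :=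
    (integrable_const 1).indicator hI
  have key : ∫ z : ℝ × ℝ, (z.1 - z.2) ^ 2 ∂(ν.prod ν)
      ≤ ∫ z : ℝ × ℝ, (1 + (K / 2 * I.indicator (fun _ => (1 : ℝ)) z
        + 1 / (2 * K) * (8 * (z.1 ^ 4 + z.2 ^ 4)))) ∂(ν.prod ν) := by
    refine integral_mono_of_nonneg (ae_of_all _ fun z => sq_nonneg _)
      ((integrable_const 1).add ((iI.const_mul _).add (i4.const_mul _))) (ae_of_all _ fun z => ?_)
    simp only
    have h4 : (z.1 - z.2) ^ 4 ≤ 8 * (z.1 ^ 4 + z.2 ^ 4) := by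
      nlinarith [sq_nonneg ((z.1 + z.2) ^ 2), sq_nonneg (z.1 ^ 2 - z.2 ^ 2),
        sq_nonneg (z.1 * (z.1 + z.2)), sq_nonneg (z.2 * (z.1 + z.2)), sq_nonneg (z.1 + z.2),
        sq_nonneg ((z.1 - z.2) ^ 2 - (z.1 + z.2) ^ 2), sq_nonneg (z.1 * z.2)]
    by_cases hz : z ∈ I
    · rw [Set.indicator_of_mem hz]
      have h5 : (z.1 - z.2) ^ 2 ≤ K / 2 + 1 / (2 * K) * (z.1 - z.2) ^ 4 := by
        have : K / 2 + 1 / (2 * K) * (z.1 - z.2) ^ 4 - (z.1 - z.2) ^ 2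
            = ((z.1 - z.2) ^ 2 - K) ^ 2 / (2 * K) := by field_simp; ring
        have h0 : 0 ≤ ((z.1 - z.2) ^ 2 - K) ^ 2 / (2 * K) := by positivity
        linarith
      have h6 : 1 / (2 * K) * (z.1 - z.2) ^ 4 ≤ 1 / (2 * K) * (8 * (z.1 ^ 4 + z.2 ^ 4)) := by
        gcongr
      linarith
    · rw [Set.indicator_of_notMem hz]
      have h5 : |z.1 - z.2| < 1 := not_le.1 hz
      have h6 : (z.1 - z.2) ^ 2 ≤ 1 := by
        rw [← sq_abs]; exact pow_le_one₀ (abs_nonneg _) h5.le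
      have h7 : 0 ≤ 1 / (2 * K) * (8 * (z.1 ^ 4 + z.2 ^ 4)) := by positivity
      linarith
  have iR : Integrable (fun z : ℝ × ℝ => K / 2 * I.indicator (fun _ => (1 : ℝ)) z
        + 1 / (2 * K) * (8 * (z.1 ^ 4 + z.2 ^ 4))) (ν.prod ν) :=
    (iI.const_mul _).add (i4.const_mul _)
  rw [e2, integral_add (integrable_const _) iR, integral_add (iI.const_mul _) (i4.const_mul _),
    integral_const_mul, integral_const_mul, integral_indicator_const _ hI] at key
  simp only [integral_const, probReal_univ, smul_eq_mul, mul_one] at key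
  have h8 : 1 / (2 * K) * ∫ z : ℝ × ℝ, 8 * (z.1 ^ 4 + z.2 ^ 4) ∂(ν.prod ν) ≤ 1 / 2 := by
    calc _ ≤ 1 / (2 * K) * K := by gcongr
      _ = 1 / 2 := by field_simp
  have h9 : 1 ≤ K * (ν.prod ν).real I := by linarith
  rw [hK, div_mul_eq_mul_div, le_div_iff₀ (by positivity)] at h9
  linarith

/-- Discard the complement of `I`, then apply Jensen to the conditional law. This moves the average
over increments out of the exponent, so that the increment can be fixed when integrating over the
Gaussian. -/
lemma exp_neg_integral_le_integral_cond {X : Type*} [MeasurableSpace X] {η : Measure X}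
    [IsProbabilityMeasure η] {I : Set X} {p : ℝ} (hp : 0 < p)
    (hpI : p ≤ η.real I) {f : X → ℝ} (hf : Integrable f η) (hf0 : ∀ x, 0 ≤ f x) :
    Real.exp (-4 * ∫ x, f x ∂η) ≤ ∫ x, Real.exp (-4 * p * f x) ∂(cond η I) := by
  have hI0 : η I ≠ 0 := fun h0 => by
    rw [measureReal_def, h0] at hpI; simp at hpI; linarith
  have := cond_isProbabilityMeasure hI0
  have hfc : Integrable f (cond η I) := by
    unfold ProbabilityTheory.cond
    exact hf.integrableOn.smul_measure (by simpa using hI0)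
  have h1 : p * ∫ x, f x ∂(cond η I) ≤ ∫ x, f x ∂η := by
    have h2 : ∫ x, f x ∂(cond η I) = (η.real I)⁻¹ * ∫ x in I, f x ∂η := by
      unfold ProbabilityTheory.cond
      rw [integral_smul_measure, ENNReal.toReal_inv, smul_eq_mul, measureReal_def]
    have h3 : ∫ x in I, f x ∂η ≤ ∫ x, f x ∂η :=
      setIntegral_le_integral hf (ae_of_all _ hf0)
    have h4 : 0 ≤ ∫ x in I, f x ∂η := integral_nonneg hf0
    have h5 : 0 < η.real I := hp.trans_le hpI
    rw [h2, ← mul_assoc]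
    refine le_trans ?_ h3
    refine mul_le_of_le_one_left h4 ?_
    rw [← div_eq_mul_inv]
    exact (div_le_one h5).2 hpI
  have hi : Integrable (fun x => Real.exp (-4 * p * f x)) (cond η I) := by
    refine (integrable_const (1 : ℝ)).mono'
      (Real.continuous_exp.comp_aestronglyMeasurable (hfc.1.const_mul _))
      (ae_of_all _ fun x => ?_)
    rw [Real.norm_of_nonneg (Real.exp_pos _).le, Real.exp_le_one_iff]
    have := mul_nonneg hp.le (hf0 x)
    nlinarith
  calc Real.exp (-4 * ∫ x, f x ∂η) ≤ Real.exp (∫ x, -4 * p * f x ∂(cond η I)) := by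
        rw [Real.exp_le_exp, integral_const_mul]; linarith
    _ ≤ _ := convexOn_exp.map_integral_le Real.continuous_exp.continuousOn isClosed_univ
        (ae_of_all _ fun _ => Set.mem_univ _) (hfc.const_mul _) hi

lemma ofReal_integral_le_lintegral {X : Type*} [MeasurableSpace X] {η : Measure X} {f : X → ℝ}
    (hf : ∀ x, 0 ≤ f x) : ENNReal.ofReal (∫ x, f x ∂η) ≤ ∫⁻ x, ENNReal.ofReal (f x) ∂η := by
  by_cases hi : Integrable f η
  · rw [ofReal_integral_eq_lintegral_ofReal hi (ae_of_all _ hf)]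
  · rw [integral_undef hi]; simp

/-- The small ball estimate for the scalar product of a random row with a vector which is far
from having small denominators. -/
lemma IsStdSubgaussian.small_ball {ν : Measure ℝ} [IsProbabilityMeasure ν] {lam : ℝ}
    (h : IsStdSubgaussian ν lam) {N : ℕ} {γ α D t : ℝ} {y : EuclideanSpace ℝ (Fin N)}
    (hy : FarFromLattice γ α D y) (hγ : 0 < γ) (hα : 0 ≤ α) (ht : 0 < t) (htD : 1 ≤ t * D) :
    ∫⁻ v, ENNReal.ofReal (Real.exp (-(1 / t ^ 2) * rowDot y v ^ 2)) ∂rowLaw ν N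
      ≤ ENNReal.ofReal (3 * (√(Real.pi / (lam ^ 2 / 96)) / (2 * (1 / (5 * t)) * γ)
        + Real.exp (-(lam ^ 2 / 96) * α ^ 2))) := by
  have hl := h.lam_pos
  set p : ℝ := lam ^ 2 / 96 with hpdef
  have hp : 0 < p := by positivity
  set I : Set (ℝ × ℝ) := {z | 1 ≤ |z.1 - z.2|} with hIdef
  have hI : MeasurableSet I := (isClosed_le (by fun_prop) (by fun_prop)).measurableSet
  have hpI := h.measure_one_le_abs_sub
  set b : ℝ := √(2 * (1 / t ^ 2)) with hb
  have hbt : b = √2 / t := by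
    rw [hb, mul_one_div, Real.sqrt_div' _ (by positivity), Real.sqrt_sq ht.le]
  have hI0 : (ν.prod ν) I ≠ 0 := fun h0 => by
    rw [measureReal_def, h0] at hpI; simp at hpI; linarith
  have hprob := cond_isProbabilityMeasure hI0
  have hi : Integrable (fun v => Real.exp (-(1 / t ^ 2) * rowDot y v ^ 2)) (rowLaw ν N) := by
    refine (integrable_const (1 : ℝ)).mono' (by fun_prop) (ae_of_all _ fun v => ?_)
    rw [Real.norm_of_nonneg (Real.exp_pos _).le, Real.exp_le_one_iff, neg_mul, neg_nonpos]
    positivity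
  have hD2 : Measurable fun q : ℝ × ℝ × ℝ =>
      latDist ((b * q.1 * (q.2.1 - q.2.2) / (2 * Real.pi)) • y) :=
    continuous_latDist.measurable.comp (by fun_prop)
  set M := ENNReal.ofReal (√(Real.pi / p) / (2 * (1 / (5 * t)) * γ) + Real.exp (-p * α ^ 2))
  rw [← ofReal_integral_eq_lintegral_ofReal hi (ae_of_all _ fun x => (Real.exp_pos _).le)]
  calc ENNReal.ofReal (∫ v, Real.exp (-(1 / t ^ 2) * rowDot y v ^ 2) ∂rowLaw ν N)
      ≤ ENNReal.ofReal (∫ g, ‖∫ v, Complex.exp ((b * g : ℝ) * rowDot y v * Complex.I)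
          ∂rowLaw ν N‖ ∂(gaussianReal 0 1)) :=
        ENNReal.ofReal_le_ofReal (integral_exp_neg_sq_le_integral_norm y (by positivity))
    _ ≤ ∫⁻ g, ENNReal.ofReal ‖∫ v, Complex.exp ((b * g : ℝ) * rowDot y v * Complex.I)
          ∂rowLaw ν N‖ ∂(gaussianReal 0 1) := ofReal_integral_le_lintegral fun _ => norm_nonneg _
    _ ≤ ∫⁻ g, ∫⁻ z, ENNReal.ofReal (Real.exp (-4 * p *
          latDist ((b * g * (z.1 - z.2) / (2 * Real.pi)) • y) ^ 2))
          ∂(cond (ν.prod ν) I) ∂(gaussianReal 0 1) := by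
        refine lintegral_mono fun g => ?_
        refine le_trans (ENNReal.ofReal_le_ofReal ((norm_integral_cexp_rowDot_le y (b * g)).trans
          (exp_neg_integral_le_integral_cond hp hpI (integrable_latDist_sq _ (by fun_prop))
          fun _ => sq_nonneg _))) (ofReal_integral_le_lintegral fun _ => (Real.exp_pos _).le)
    _ = ∫⁻ z, ∫⁻ g, ENNReal.ofReal (Real.exp (-4 * p *
          latDist ((b * g * (z.1 - z.2) / (2 * Real.pi)) • y) ^ 2))
          ∂(gaussianReal 0 1) ∂(cond (ν.prod ν) I) :=
        lintegral_lintegral_swap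
          ((hD2.pow_const 2).const_mul (-4 * p)).exp.ennreal_ofReal.aemeasurable
    _ ≤ ∫⁻ _z, 3 * M ∂(cond (ν.prod ν) I) := by
        refine lintegral_mono_ae ?_
        filter_upwards [ae_cond_mem hI] with z hz
        have hz : 1 ≤ |z.1 - z.2| := hz
        -- Since `1 / 5 ≤ √2 / (2π)`, this `r` is at most `W` as soon as the increment is at least
        -- `1`; and `2 r < D` follows from `1 ≤ t * D`.
        have h1 := hy.lintegral_gaussian_le hγ hα (r := 1 / (5 * t))
          (W := |b * (z.1 - z.2) / (2 * Real.pi)|) (p := p) (by positivity) (by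
            rw [mul_one_div, div_lt_iff₀ (by positivity)]; linarith) (by
            rw [abs_div, abs_mul, abs_of_pos (by positivity : 0 < 2 * Real.pi), hbt,
              abs_of_pos (by positivity : 0 < √2 / t)]
            have h2 : (1.4 : ℝ) ≤ √2 := Real.le_sqrt_of_sq_le (by norm_num)
            have h3 := Real.pi_lt_d2
            have h4 : 1 / 5 ≤ √2 / (2 * Real.pi) := by
              rw [div_le_div_iff₀ (by norm_num) (by positivity)]
              linarith
            calc 1 / (5 * t) = (1 / 5) / t * 1 := by field_simp
              _ ≤ (√2 / (2 * Real.pi)) / t * |z.1 - z.2| := by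
                gcongr
              _ = _ := by field_simp) hp
        refine le_trans (le_of_eq (lintegral_congr fun g => ?_)) h1
        congr 4
        have h4 : b * g * (z.1 - z.2) / (2 * Real.pi) = b * (z.1 - z.2) / (2 * Real.pi) * g := by
          ring
        rw [h4]
        rcases abs_choice (b * (z.1 - z.2) / (2 * Real.pi)) with h5 | h5 <;> rw [h5]
        rw [neg_mul, neg_smul, latDist_neg]
    _ = 3 * M := by simp
    _ = _ := by
        rw [ENNReal.ofReal_mul (by norm_num : (0 : ℝ) ≤ 3)]
        congr 1
        simp

/-! ### Discretization of kernel vectors by lattice directions. -/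

/-- Normalizing the lattice point eliminates the continuous parameter `θ` at the cost of a factor
`2`, so that only finitely many directions remain. -/
lemma norm_sub_normalize_le {E : Type*} [NormedAddCommGroup E] [NormedSpace ℝ E] {x z : E}
    {θ δ : ℝ} (hx : ‖x‖ = 1) (hθ : 0 < θ) (hz : z ≠ 0) (h : ‖θ • x - z‖ ≤ δ * θ) :
    ‖x - ‖z‖⁻¹ • z‖ ≤ 2 * δ := by
  have hz' : 0 < ‖z‖ := norm_pos_iff.2 hz
  have h1 : ‖x - θ⁻¹ • z‖ ≤ δ := by
    have : x - θ⁻¹ • z = θ⁻¹ • (θ • x - z) := by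
      rw [smul_sub, smul_smul, inv_mul_cancel₀ hθ.ne', one_smul]
    rw [this, norm_smul, norm_inv, Real.norm_of_nonneg hθ.le, inv_mul_le_iff₀ hθ]
    linarith
  have h2 : ‖θ⁻¹ • z - ‖z‖⁻¹ • z‖ ≤ δ := by
    rw [← sub_smul, norm_smul, Real.norm_eq_abs]
    have h3 : |‖θ • x‖ - ‖z‖| ≤ δ * θ := (abs_norm_sub_norm_le _ _).trans h
    rw [norm_smul, hx, mul_one, Real.norm_of_nonneg hθ.le] at h3
    have h4 : |θ⁻¹ - ‖z‖⁻¹| * ‖z‖ = |θ - ‖z‖| * θ⁻¹ := by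
      have : (θ⁻¹ - ‖z‖⁻¹) * ‖z‖ = -((θ - ‖z‖) * θ⁻¹) := by field_simp; ring
      rw [← abs_of_pos hz', ← abs_mul, abs_of_pos hz', this, abs_neg, abs_mul,
        abs_of_pos (inv_pos.2 hθ)]
    rw [h4, ← div_eq_mul_inv, div_le_iff₀ hθ]
    exact h3
  calc ‖x - ‖z‖⁻¹ • z‖ = ‖(x - θ⁻¹ • z) + (θ⁻¹ • z - ‖z‖⁻¹ • z)‖ := by congr 1; abel
    _ ≤ _ := (norm_add_le _ _).trans (by linarith)

section Levels

variable {ν : Measure ℝ} [IsProbabilityMeasure ν] {lam : ℝ} {n N : ℕ}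

lemma sum_sq_rowDot_le_of_norm_sub_le {A : Fin n → Fin N → ℝ} {x y : EuclideanSpace ℝ (Fin N)}
    {K δ : ℝ} (hK : 0 ≤ K) (hA : ‖matMap A‖ ≤ K) (hx : matMap A x = 0) (hxy : ‖x - y‖ ≤ δ) :
    ∑ k, rowDot y (A k) ^ 2 ≤ (K * δ) ^ 2 := by
  rw [← norm_matMap_sq]
  refine pow_le_pow_left₀ (norm_nonneg _) ?_ 2
  have h1 : matMap A y = -(matMap A (x - y)) := by rw [map_sub, hx]; simp
  rw [h1, norm_neg]
  exact ((matMap A).le_opNorm _).trans (mul_le_mul hA hxy (norm_nonneg _) hK)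

lemma ne_zero_of_norm_sub_lt {x z : EuclideanSpace ℝ (Fin N)} {θ γ : ℝ} (hx : ‖x‖ = 1)
    (hθ : 0 < θ) (hγ : γ ≤ 1) (h : ‖θ • x - z‖ < γ * θ) : z ≠ 0 := by
  rintro rfl
  rw [sub_zero, norm_smul, hx, mul_one, Real.norm_of_nonneg hθ.le] at h
  nlinarith

lemma norm_le_of_norm_sub_lt {x z : EuclideanSpace ℝ (Fin N)} {θ γ : ℝ} (hx : ‖x‖ = 1)
    (hθ : 0 < θ) (hγ : γ ≤ 1) (h : ‖θ • x - z‖ < γ * θ) : ‖z‖ ≤ 2 * θ := by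
  have h1 := norm_le_norm_add_norm_sub' z (θ • x)
  rw [norm_sub_rev, norm_smul, hx, mul_one, Real.norm_of_nonneg hθ.le] at h1
  nlinarith

/-- Vectors with a very small denominator are unlikely to lie in the kernel. -/
lemma matLaw_small_denominator_le (h : IsStdSubgaussian ν lam) {K γ R : ℝ} (hK : 0 ≤ K)
    (hγ : γ ≤ 1) (hKγ : (K * (2 * γ)) ^ 2 ≤ n / 4) :
    matLaw ν n N {A | ‖matMap A‖ ≤ K ∧ ∃ x, ‖x‖ = 1 ∧ matMap A x = 0 ∧
        ∃ θ, 0 < θ ∧ θ < R ∧ latDist (θ • x) < γ * θ}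
      ≤ ENNReal.ofReal ((latticeBall N (2 * R)).card * Real.exp (-(lam ^ 2 / 4096 * n))) := by
  set T := {p ∈ latticeBall N (2 * R) | intVec p ≠ 0}
  have h1 := matLaw_le_card_mul (ν := ν) (n := n) (κ := lam ^ 2 / 1024)
    (q := Real.exp (-(lam ^ 2 / 2048))) (w := lam ^ 2 / 1024 * (n / 4)) T
    (fun p => ‖intVec p‖⁻¹ • intVec p)
    (fun p hp => lintegral_exp_neg_sq_rowDot_le h (by
      rw [norm_smul, norm_inv, norm_norm, inv_mul_cancel₀]
      exact norm_ne_zero_iff.2 (Finset.mem_filter.1 hp).2)) (Real.exp_pos _).le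
    (E := {A | ‖matMap A‖ ≤ K ∧ ∃ x, ‖x‖ = 1 ∧ matMap A x = 0 ∧
        ∃ θ, 0 < θ ∧ θ < R ∧ latDist (θ • x) < γ * θ}) (by
      rintro A ⟨hA, x, hx, hAx, θ, hθ, hθR, hd⟩
      obtain ⟨p, hp⟩ := exists_of_latDist_lt hd
      have hp0 := ne_zero_of_norm_sub_lt hx hθ hγ hp
      refine ⟨p, Finset.mem_filter.2 ⟨mem_latticeBall.2 ?_, hp0⟩, ?_⟩
      · exact (norm_le_of_norm_sub_lt hx hθ hγ hp).trans (by linarith)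
      · have h2 := sum_sq_rowDot_le_of_norm_sub_le hK hA hAx
          (norm_sub_normalize_le hx hθ hp0 hp.le)
        have := h2.trans hKγ
        gcongr)
  refine h1.trans (ENNReal.ofReal_le_ofReal ?_)
  rw [← Real.exp_nat_mul, ← Real.exp_add]
  gcongr
  · exact Finset.filter_subset _ _
  · apply le_of_eq; ring

/-- Unit vectors with least denominator in `[D, 2 D)` are unlikely to lie in the kernel. -/
lemma matLaw_level_le (h : IsStdSubgaussian ν lam) {K γ α D t : ℝ} (hK : 0 ≤ K) (hγ0 : 0 < γ)
    (hγ : γ ≤ 1) (hα : 0 ≤ α) (hD : 0 < D) (ht : 0 < t) (htD : 1 ≤ t * D)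
    (hKt : (K * (4 * (α / D))) ^ 2 ≤ t ^ 2 * n) :
    matLaw ν n N {A | ‖matMap A‖ ≤ K ∧ ∃ x, ‖x‖ = 1 ∧ matMap A x = 0 ∧ FarFromLattice γ α D x ∧
        ∃ θ, D ≤ θ ∧ θ < 2 * D ∧ latDist (θ • x) < min (γ * θ) α}
      ≤ ENNReal.ofReal ((latticeBall N (4 * D)).card * (Real.exp n *
        (3 * (√(Real.pi / (lam ^ 2 / 96)) / (2 * (1 / (5 * t)) * γ)
        + Real.exp (-(lam ^ 2 / 96) * α ^ 2))) ^ n)) := by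
  classical
  -- The small ball estimate needs a vector far from the lattice, which the direction of `p` itself
  -- need not be. Each `p` is therefore represented by one admissible vector near that direction;
  -- two admissible vectors for the same `p` are within `4 * (α / D)`.
  let G : (Fin N → ℤ) → EuclideanSpace ℝ (Fin N) → Prop := fun p x =>
    ‖x‖ = 1 ∧ FarFromLattice γ α D x ∧
      ∃ θ, D ≤ θ ∧ θ < 2 * D ∧ ‖θ • x - intVec p‖ < min (γ * θ) α
  let y : (Fin N → ℤ) → EuclideanSpace ℝ (Fin N) := fun p =>
    if hp : ∃ x, G p x then hp.choose else 0
  have hy : ∀ p, (∃ x, G p x) → G p (y p) := fun p hp => by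
    simp only [y, dif_pos hp]; exact hp.choose_spec
  have near : ∀ p x, G p x → ‖x - ‖intVec p‖⁻¹ • intVec p‖ ≤ 2 * (α / D) := by
    rintro p x ⟨hx, -, θ, hDθ, -, hp⟩
    have hθ := hD.trans_le hDθ
    refine norm_sub_normalize_le hx hθ
      (ne_zero_of_norm_sub_lt hx hθ hγ (hp.trans_le (min_le_left _ _))) ?_
    refine (hp.le.trans (min_le_right _ _)).trans ?_
    rw [div_mul_eq_mul_div, le_div_iff₀ hD]
    gcongr
  set T := {p ∈ latticeBall N (4 * D) | ∃ x, G p x}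
  have h1 := matLaw_le_card_mul (ν := ν) (n := n) (κ := 1 / t ^ 2) (w := n) T y
    (fun p hp => h.small_ball (hy p (Finset.mem_filter.1 hp).2).2.1 hγ0 hα ht htD)
    (by positivity)
    (E := {A | ‖matMap A‖ ≤ K ∧ ∃ x, ‖x‖ = 1 ∧ matMap A x = 0 ∧ FarFromLattice γ α D x ∧
        ∃ θ, D ≤ θ ∧ θ < 2 * D ∧ latDist (θ • x) < min (γ * θ) α}) (by
      rintro A ⟨hA, x, hx, hAx, hfar, θ, hDθ, hθD, hd⟩
      obtain ⟨p, hp⟩ := exists_of_latDist_lt hd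
      have hG : G p x := ⟨hx, hfar, θ, hDθ, hθD, hp⟩
      refine ⟨p, Finset.mem_filter.2 ⟨mem_latticeBall.2 ?_, x, hG⟩, ?_⟩
      · exact (norm_le_of_norm_sub_lt hx (hD.trans_le hDθ) hγ
          (hp.trans_le (min_le_left _ _))).trans (by linarith)
      · have h2 := near p x hG
        have h3 := near p (y p) (hy p ⟨x, hG⟩)
        have h4 : ‖x - y p‖ ≤ 4 * (α / D) := by
          have h5 : x - y p = (x - ‖intVec p‖⁻¹ • intVec p)
              - (y p - ‖intVec p‖⁻¹ • intVec p) := by abel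
          rw [h5]
          exact (norm_sub_le _ _).trans (by linarith)
        have h6 := (sum_sq_rowDot_le_of_norm_sub_le hK hA hAx h4).trans hKt
        rw [div_mul_eq_mul_div, one_mul, div_le_iff₀ (by positivity)]
        linarith)
  refine h1.trans (ENNReal.ofReal_le_ofReal ?_)
  gcongr
  exact Finset.filter_subset _ _

end Levels

/-- A small least common denominator of a subspace is witnessed by one of its unit vectors. -/
lemma exists_of_subspaceLCD_lt {N : ℕ} {α γ L : ℝ}
    {E : Submodule ℝ (EuclideanSpace ℝ (Fin N))}
    (h : subspaceLCD α γ E < ENNReal.ofReal L) :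
    ∃ x ∈ E, ‖x‖ = 1 ∧ ∃ θ, 0 < θ ∧ θ < L ∧ latDist (θ • x) < min (γ * θ) α := by
  unfold subspaceLCD at h
  simp only [iInf_lt_iff] at h
  obtain ⟨x, ⟨hxE, hx⟩, h⟩ := h
  unfold vectorLCD at h
  simp only [iInf_lt_iff] at h
  obtain ⟨θ, ⟨hθ, hd⟩, h⟩ := h
  refine ⟨x, hxE, hx, θ, hθ, (ENNReal.ofReal_lt_ofReal_iff'.1 h).1, ?_⟩
  rwa [norm_smul, hx, mul_one, Real.norm_of_nonneg hθ.le] at hd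

/-- Dyadic decomposition according to the least denominator of a unit vector. -/
lemma exists_dyadic_level {N : ℕ} {α γ R L : ℝ} (hR : 0 < R) {x : EuclideanSpace ℝ (Fin N)}
    (h : ∃ θ, 0 < θ ∧ θ < L ∧ latDist (θ • x) < min (γ * θ) α) :
    (∃ θ, 0 < θ ∧ θ < R ∧ latDist (θ • x) < min (γ * θ) α) ∨
      ∃ k : ℕ, 2 ^ k * R < L ∧ FarFromLattice γ α (2 ^ k * R) x ∧
        ∃ θ, 2 ^ k * R ≤ θ ∧ θ < 2 * (2 ^ k * R) ∧ latDist (θ • x) < min (γ * θ) α := by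
  classical
  let P : ℕ → Prop := fun j => ∃ θ, 0 < θ ∧ θ < 2 ^ j * R ∧ latDist (θ • x) < min (γ * θ) α
  obtain ⟨θ₀, hθ₀, hL, hd₀⟩ := h
  have hP : ∃ j, P j := by
    obtain ⟨j, hj⟩ := pow_unbounded_of_one_lt (θ₀ / R) (one_lt_two (α := ℝ))
    exact ⟨j, θ₀, hθ₀, (div_lt_iff₀ hR).1 hj, hd₀⟩
  have hspec := Nat.find_spec hP
  rcases hj : Nat.find hP with _ | k
  · rw [hj] at hspec
    left
    simpa [P] using hspec
  · rw [hj] at hspec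
    have hk : ¬ P k := Nat.find_min hP (by omega)
    have far : ∀ θ, 0 < θ → latDist (θ • x) < min (γ * θ) α → 2 ^ k * R ≤ θ := by
      intro θ hθ hd
      by_contra hc
      exact hk ⟨θ, hθ, not_le.1 hc, hd⟩
    right
    obtain ⟨θ, hθ, hlt, hd⟩ := hspec
    refine ⟨k, (far θ₀ hθ₀ hd₀).trans_lt hL, fun θ' h0 hlt' => ?_, θ, far θ hθ hd, ?_, hd⟩
    · by_contra hc
      exact absurd (far θ' h0 (not_le.1 hc)) (not_le.2 hlt')
    · rw [pow_succ] at hlt; linarith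

/-! ### From the subgaussian hypotheses to a product law. -/

/-- Layer cake: the tail of `e^{X²/(2b²)}` at `s > 1` is at most `2 s^{-2}`, so the total is at most
`1 + 2`. -/
lemma lintegral_exp_sq_le_three {Ω : Type*} [MeasurableSpace Ω] {μ : Measure Ω}
    [IsProbabilityMeasure μ] {X : Ω → ℝ} (hX : Measurable X) {b : ℝ}
    (hb : b ∈ subgaussianBounds X μ) :
    ∫⁻ ω, ENNReal.ofReal (Real.exp (1 / (2 * b ^ 2) * X ω ^ 2)) ∂μ ≤ 3 := by
  obtain ⟨hb0, hb⟩ := hb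
  rw [lintegral_eq_lintegral_meas_lt μ (ae_of_all _ fun ω => (Real.exp_pos _).le) (by fun_prop)]
  have htail : ∀ s ∈ Set.Ioi (1 : ℝ), μ {ω | s < Real.exp (1 / (2 * b ^ 2) * X ω ^ 2)}
      ≤ ENNReal.ofReal (2 * s ^ (-2 : ℝ)) := by
    intro s hs
    have hs : 1 < s := hs
    have hlog := Real.log_pos hs
    have h1 : {ω | s < Real.exp (1 / (2 * b ^ 2) * X ω ^ 2)}
        ⊆ {ω | √(2 * b ^ 2 * Real.log s) < |X ω|} := by
      intro ω hω
      have hω : s < Real.exp (1 / (2 * b ^ 2) * X ω ^ 2) := hω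
      rw [← Real.log_lt_iff_lt_exp (by linarith), one_div, lt_inv_mul_iff₀ (by positivity)] at hω
      change √(2 * b ^ 2 * Real.log s) < |X ω|
      rw [← Real.sqrt_sq_eq_abs]
      exact Real.sqrt_lt_sqrt (by positivity) hω
    refine (measure_mono h1).trans ?_
    have h2 := hb (√(2 * b ^ 2 * Real.log s)) (by positivity)
    rw [← ENNReal.ofReal_toReal (measure_ne_top μ _)]
    refine ENNReal.ofReal_le_ofReal (h2.trans (le_of_eq ?_))
    rw [Real.sq_sqrt (by positivity), Real.rpow_def_of_pos (by linarith)]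
    congr 2
    field_simp
  have hunion : Set.Ioi (0 : ℝ) = Set.Ioc 0 1 ∪ Set.Ioi 1 :=
    (Set.Ioc_union_Ioi_eq_Ioi zero_le_one).symm
  rw [hunion]
  refine (lintegral_union_le _ _ _).trans ?_
  have h1 : ∫⁻ s in Set.Ioc (0 : ℝ) 1, μ {ω | s < Real.exp (1 / (2 * b ^ 2) * X ω ^ 2)} ≤ 1 :=
    (lintegral_mono fun s => prob_le_one).trans (by simp)
  have h2 : ∫⁻ s in Set.Ioi (1 : ℝ), μ {ω | s < Real.exp (1 / (2 * b ^ 2) * X ω ^ 2)} ≤ 2 := by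
    refine (setLIntegral_mono (by fun_prop) htail).trans ?_
    have hi : IntegrableOn (fun s : ℝ => 2 * s ^ (-2 : ℝ)) (Set.Ioi 1) :=
      (integrableOn_Ioi_rpow_of_lt (by norm_num) one_pos).const_mul 2
    rw [← ofReal_integral_eq_lintegral_ofReal hi, integral_const_mul,
      integral_Ioi_rpow_of_lt (by norm_num) one_pos]
    · norm_num
    · filter_upwards [ae_restrict_mem measurableSet_Ioi] with s hs
      have : (0 : ℝ) < s := lt_trans one_pos hs
      positivity
  calc _ ≤ (1 : ENNReal) + 2 := add_le_add h1 h2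
    _ = 3 := by norm_num

lemma IsSubgaussian.isStdSubgaussian {Ω : Type*} [MeasurableSpace Ω] {μ : Measure Ω}
    [IsProbabilityMeasure μ] {X : Ω → ℝ} (hX : Measurable X) {B : ℝ} (hs : IsSubgaussian X μ)
    (hB : subgaussianMoment X μ ≤ B) (hmean : ∫ ω, X ω ∂μ = 0) (hvar : variance X μ = 1) :
    IsStdSubgaussian (μ.map X) (1 / (2 * (|B| + 1) ^ 2)) where
  lam_pos := by positivity
  mean := by rw [integral_map hX.aemeasurable (by fun_prop), hmean]
  second := by
    rw [integral_map hX.aemeasurable (by fun_prop), ← hvar,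
      variance_of_integral_eq_zero hX.aemeasurable hmean]
  expSq := by
    rw [lintegral_map (by fun_prop) hX]
    refine lintegral_exp_sq_le_three hX ⟨by positivity, fun t ht => ?_⟩
    -- `|B| + 1` strictly exceeds the infimum, so attainment is not needed, and it is positive
    -- whatever the sign of `B`.
    obtain ⟨b, ⟨hb0, hb⟩, hlt⟩ := exists_lt_of_csInf_lt hs
      (show sInf (subgaussianBounds X μ) < |B| + 1 from
        lt_of_le_of_lt hB (by linarith [le_abs_self B]))
    refine (hb t ht).trans ?_
    have h1 : b ^ 2 ≤ (|B| + 1) ^ 2 := pow_le_pow_left₀ hb0.le hlt.le 2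
    rw [neg_div, neg_div]
    gcongr

lemma map_eq_matLaw {Ω : Type*} [MeasurableSpace Ω] {μ : Measure Ω} [IsProbabilityMeasure μ]
    {n N : ℕ} {ξ : Fin n → Fin N → Ω → ℝ} {ν : Measure ℝ} (hm : ∀ i j, Measurable (ξ i j))
    (hind : iIndepFun (fun p : Fin n × Fin N => ξ p.1 p.2) μ)
    (hν : ∀ i j, μ.map (ξ i j) = ν) [IsProbabilityMeasure ν] :
    μ.map (fun ω i j => ξ i j ω) = matLaw ν n N := by
  have h1 := hind.map_fun_eq_pi_map fun (p : Fin n × Fin N) => (hm p.1 p.2).aemeasurable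
  simp_rw [hν] at h1
  have h2 : (fun ω i j => ξ i j ω)
      = (MeasurableEquiv.curry (Fin n) (Fin N) ℝ) ∘ fun ω (p : Fin n × Fin N) => ξ p.1 p.2 ω := rfl
  rw [h2, ← Measure.map_map (by fun_prop) (by fun_prop), h1]
  have h3 := Measure.infinitePi_map_curry (fun (_ : Fin n) (_ : Fin N) => ν)
  simp_rw [Measure.infinitePi_eq_pi] at h3
  exact h3

/-! ### Choice of constants and summation over the levels. -/

/-- Entropy against small ball: the powers of `x` cancel down to `x ^ m`, at most `e^{cN}`. Together
with `C₁ ^ m ≤ e^N` this costs at most `e^{2N}`, which `e^{-8n}` absorbs because `N ≤ 2n`. -/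
lemma pow_mul_exp_mul_pow_le {n m : ℕ} {C₁ C₃ μ x c : ℝ} (hm : 1 ≤ m) (hn : m ≤ n)
    (hC₁ : 1 ≤ C₁) (hx : 0 < x) (hc : c ≤ 1)
    (hxle : x ≤ Real.exp (c * ((n + m : ℕ) : ℝ) / m))
    (hlog : m * Real.log C₁ ≤ ((n + m : ℕ) : ℝ))
    (hμ : C₁ * Real.exp 1 * C₃ * μ = Real.exp (-8)) :
    (C₁ * x) ^ (n + m) * (Real.exp n * (C₃ * μ / x) ^ n)
      ≤ Real.exp (-2 * ((n + m : ℕ) : ℝ)) := by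
  have hm0 : (0 : ℝ) < m := by exact_mod_cast hm
  have hn' : (m : ℝ) ≤ n := by exact_mod_cast hn
  have h1 : (C₁ * x) ^ (n + m) * (Real.exp n * (C₃ * μ / x) ^ n)
      = Real.exp (-8) ^ n * (C₁ * x) ^ m := by
    rw [show Real.exp (n : ℝ) = Real.exp 1 ^ n by rw [← Real.exp_nat_mul, mul_one], ← hμ, pow_add,
      mul_right_comm, ← mul_pow, ← mul_pow]
    congr 2
    field_simp
  have h2 : (C₁ * x) ^ m ≤ Real.exp (2 * ((n + m : ℕ) : ℝ)) := by
    calc (C₁ * x) ^ m ≤ (Real.exp (Real.log C₁) * Real.exp (c * ((n + m : ℕ) : ℝ) / m)) ^ m := by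
          rw [Real.exp_log (by linarith)]; gcongr
      _ = Real.exp (m * Real.log C₁ + c * ((n + m : ℕ) : ℝ)) := by
          rw [← Real.exp_add, ← Real.exp_nat_mul]; congr 1; field_simp
      _ ≤ _ := by
          rw [Real.exp_le_exp]
          have : (0 : ℝ) ≤ ((n + m : ℕ) : ℝ) := Nat.cast_nonneg _
          nlinarith
  rw [h1]
  calc _ ≤ Real.exp (-8) ^ n * Real.exp (2 * ((n + m : ℕ) : ℝ)) := by gcongr
    _ = Real.exp (n * -8 + 2 * ((n + m : ℕ) : ℝ)) := by rw [← Real.exp_nat_mul, ← Real.exp_add]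
    _ ≤ _ := by rw [Real.exp_le_exp]; push_cast; linarith

lemma exp_neg_le_inv {x : ℝ} (hx : 0 < x) : Real.exp (-x) ≤ 1 / x := by
  rw [Real.exp_neg, one_div]
  gcongr
  linarith [Real.add_one_le_exp x]

lemma card_latticeBall_level_le {N : ℕ} (hN : 0 < N) {lm D : ℝ} (hlm : 0 < lm)
    (hD : lm * √N ≤ D) :
    ((latticeBall N (4 * D)).card : ℝ) ≤ (Real.exp 1 * (1 / lm + 8) * (D / √N)) ^ N := by
  have hs : (0 : ℝ) < √N := by positivity
  have hD0 : 0 < D := lt_of_lt_of_le (by positivity) hD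
  refine (card_latticeBall_le_pow hN (by positivity)).trans ?_
  rw [mul_assoc]
  gcongr
  have h1 : 1 ≤ 1 / lm * (D / √N) := by
    rw [one_div, ← div_eq_inv_mul, div_div, one_le_div (by positivity)]; linarith
  calc 1 + 2 * (4 * D) / √N = 1 + 8 * (D / √N) := by ring
    _ ≤ _ := by linarith

/-- There are few integer vectors of very small norm. -/
lemma card_latticeBall_small_le {N : ℕ} {κ : ℝ} (hκ : 0 < κ) :
    ((latticeBall N (2 * (κ ^ 2 / 4096 * √N))).card : ℝ) ≤ Real.exp (κ / 16 * N) := by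
  -- With this `s`, the exponential prefactor and the product over coordinates are each at most
  -- `e^{κN/32}`.
  have hs : 0 < 64 / κ := by positivity
  refine (card_latticeBall_le hs).trans ?_
  have h1 : 64 / κ * √N * (2 * (κ ^ 2 / 4096 * √N)) = κ / 32 * N := by
    have : √(N : ℝ) * √N = N := Real.mul_self_sqrt (by positivity)
    calc _ = κ / 32 * (√(N : ℝ) * √N) := by field_simp; ring
      _ = _ := by rw [this]
  have h2 : 2 / (Real.exp (64 / κ) - 1) ≤ κ / 32 := by
    have h3 : 64 / κ ≤ Real.exp (64 / κ) - 1 := by linarith [Real.add_one_le_exp (64 / κ)]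
    calc 2 / (Real.exp (64 / κ) - 1) ≤ 2 / (64 / κ) := by gcongr
      _ = κ / 32 := by field_simp; norm_num
  have h4 : 0 ≤ 2 / (Real.exp (64 / κ) - 1) := by
    have : 0 < Real.exp (64 / κ) - 1 := by linarith [Real.add_one_lt_exp hs.ne']
    positivity
  calc _ ≤ Real.exp (κ / 32 * N) * (Real.exp (κ / 32)) ^ N := by
        rw [h1]
        gcongr
        linarith [Real.add_one_le_exp (κ / 32)]
    _ = _ := by rw [← Real.exp_nat_mul, ← Real.exp_add]; congr 1; ring

/-- A bound on the probability of one dyadic level. -/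
lemma matLaw_level_le_exp {ν : Measure ℝ} [IsProbabilityMeasure ν] {lam : ℝ}
    (h : IsStdSubgaussian ν lam) {n m : ℕ} {K lm μ c D : ℝ} (hm : 1 ≤ m) (hn : m ≤ n)
    (hK : 1 ≤ K) (hlm : 0 < lm) (hμ0 : 0 < μ) (hc : c ≤ 1)
    (hD : lm * √(n + m : ℕ) ≤ D)
    (hDL : D ≤ √(n + m : ℕ) * Real.exp (c * ((n + m : ℕ) : ℝ) / m))
    (hlog : m * Real.log (Real.exp 1 * (1 / lm + 8)) ≤ ((n + m : ℕ) : ℝ))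
    (hμ : (Real.exp 1 * (1 / lm + 8)) * Real.exp 1
      * (3 * (5 / 2 * √(Real.pi / (lam ^ 2 / 96)) + 1) * (36 * K ^ 2)) * μ = Real.exp (-8))
    (hN₁ : 1 ≤ 6 * K * μ * √(n + m : ℕ)) (hcμ : c ≤ lam ^ 2 / 96 * μ ^ 2 / 2)
    (hN₂ : 1 / (36 * K ^ 2 * μ) ≤ lam ^ 2 / 96 * μ ^ 2 / 2 * ((n + m : ℕ) : ℝ)) :
    matLaw ν n (n + m) {A | ‖matMap A‖ ≤ K * √(n + m : ℕ) ∧ ∃ x, ‖x‖ = 1 ∧ matMap A x = 0 ∧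
        FarFromLattice (1 / (6 * K)) (μ * √(n + m : ℕ)) D x ∧ ∃ θ, D ≤ θ ∧ θ < 2 * D ∧
          latDist (θ • x) < min (1 / (6 * K) * θ) (μ * √(n + m : ℕ))}
      ≤ ENNReal.ofReal (Real.exp (-2 * ((n + m : ℕ) : ℝ))) := by
  have hl := h.lam_pos
  have hm' : (1 : ℝ) ≤ m := by exact_mod_cast hm
  have hn' : (m : ℝ) ≤ n := by exact_mod_cast hn
  have hlevel := pow_mul_exp_mul_pow_le (x := D / √(n + m : ℕ)) hm hn
    (C₁ := Real.exp 1 * (1 / lm + 8)) (by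
      have := Real.add_one_le_exp (1 : ℝ)
      have : 0 < 1 / lm := by positivity
      nlinarith) (by
      have : (0 : ℝ) < √(n + m : ℕ) := Real.sqrt_pos.2 (by push_cast; linarith)
      exact div_pos (lt_of_lt_of_le (by positivity) hD) this) hc (by
      rw [div_le_iff₀ (Real.sqrt_pos.2 (by push_cast; linarith))]; linarith) hlog hμ
  have hcard := card_latticeBall_level_le (N := n + m) (by omega) hlm hD
  set N : ℕ := n + m with hN
  have hNr : (N : ℝ) = n + m := by rw [hN]; push_cast; rfl
  set s := √(N : ℝ) with hs
  have hs2 : s ^ 2 = N := Real.sq_sqrt (by positivity)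
  have hs0 : 0 < s := Real.sqrt_pos.2 (by linarith)
  have hD0 : 0 < D := lt_of_lt_of_le (by positivity) hD
  set Cp := √(Real.pi / (lam ^ 2 / 96)) with hCp
  -- A kernel vector is within `4 μ s / D` of its representative, which `A` stretches by at most `K
  -- s`. The factor `6` leaves room, as `16 N ≤ 32 n ≤ 36 n`.
  set t := 6 * K * μ * s / D with ht
  have ht0 : 0 < t := by positivity
  refine (matLaw_level_le h (t := t) (by positivity) (by positivity) ?_ (by positivity) hD0 ht0
    ?_ ?_).trans (ENNReal.ofReal_le_ofReal (le_trans ?_ hlevel))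
  · rw [div_le_one (by positivity)]; linarith
  · rw [ht, div_mul_cancel₀ _ hD0.ne']; exact hN₁
  · have h1 : (K * s * (4 * (μ * s / D))) ^ 2 = (K * μ * s / D) ^ 2 * (16 * s ^ 2) := by ring
    have h2 : t ^ 2 * n = (K * μ * s / D) ^ 2 * (36 * n) := by rw [ht]; ring
    rw [h1, h2, hs2]
    exact mul_le_mul_of_nonneg_left (by linarith) (sq_nonneg _)
  · have hexp : Real.exp (-(lam ^ 2 / 96) * (μ * s) ^ 2) ≤ 36 * K ^ 2 * μ * (s / D) := by
      have h1 : -(lam ^ 2 / 96) * (μ * s) ^ 2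
          = -(lam ^ 2 / 96 * μ ^ 2 / 2 * N) + -(lam ^ 2 / 96 * μ ^ 2 / 2 * N) := by
        rw [mul_pow, hs2]; ring
      have h2 : Real.exp (-(lam ^ 2 / 96 * μ ^ 2 / 2 * N)) ≤ 36 * K ^ 2 * μ := by
        refine (Real.exp_le_exp.2 (neg_le_neg hN₂)).trans ?_
        refine (exp_neg_le_inv (by positivity)).trans (le_of_eq (one_div_one_div _))
      have h3 : Real.exp (-(lam ^ 2 / 96 * μ ^ 2 / 2 * N)) ≤ s / D := by
        have h4 : c * N / m ≤ lam ^ 2 / 96 * μ ^ 2 / 2 * N := by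
          rw [div_le_iff₀ (by linarith)]
          calc c * N ≤ lam ^ 2 / 96 * μ ^ 2 / 2 * N * 1 := by rw [mul_one]; gcongr
            _ ≤ _ := by gcongr
        calc _ ≤ Real.exp (-(c * N / m)) := Real.exp_le_exp.2 (neg_le_neg h4)
          _ ≤ s / D := by
            rw [Real.exp_neg, le_div_iff₀ hD0, inv_mul_le_iff₀ (Real.exp_pos _)]
            linarith
      rw [h1, Real.exp_add]
      gcongr
    have hq : 3 * (Cp / (2 * (1 / (5 * t)) * (1 / (6 * K)))
        + Real.exp (-(lam ^ 2 / 96) * (μ * s) ^ 2))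
        ≤ 3 * (5 / 2 * Cp + 1) * (36 * K ^ 2) * μ / (D / s) := by
      have h1 : Cp / (2 * (1 / (5 * t)) * (1 / (6 * K))) = 5 / 2 * Cp * (36 * K ^ 2 * μ * (s / D)) := by
        rw [ht]; field_simp; norm_num
      have h2 : 3 * (5 / 2 * Cp + 1) * (36 * K ^ 2) * μ / (D / s)
          = 3 * (5 / 2 * Cp * (36 * K ^ 2 * μ * (s / D)) + 36 * K ^ 2 * μ * (s / D)) := by
        field_simp
      rw [h1, h2]
      gcongr
    gcongr

lemma exp_two_mul_le_two_pow (N : ℕ) : Real.exp (2 * N) ≤ 2 ^ (3 * N) := by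
  rw [pow_mul, mul_comm, Real.exp_nat_mul]
  gcongr
  rw [show (2 : ℝ) = (2 : ℕ) * 1 by norm_num, Real.exp_nat_mul]
  have := Real.exp_one_lt_d9
  calc Real.exp 1 ^ 2 ≤ 2.8 ^ 2 := by gcongr; linarith
    _ ≤ _ := by norm_num

/-- The probability bound for a random matrix, from its constants. -/
lemma matLaw_subspaceLCD_le {ν : Measure ℝ} [IsProbabilityMeasure ν] {lam : ℝ}
    (h : IsStdSubgaussian ν lam) {n m : ℕ} {K lm μ c : ℝ} (hm : 1 ≤ m) (hn : m ≤ n)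
    (hK : K = 2 * √(180 / lam) + 1) (hlm : lm = (lam ^ 2 / 1024) ^ 2 / 4096)
    (hμ0 : 0 < μ) (hμ : (Real.exp 1 * (1 / lm + 8)) * Real.exp 1
      * (3 * (5 / 2 * √(Real.pi / (lam ^ 2 / 96)) + 1) * (36 * K ^ 2)) * μ = Real.exp (-8))
    (hc0 : 0 < c) (hc : c ≤ 1 / 4) (hcγ : c ≤ 1 / (6 * K)) (hcμ : c ≤ μ)
    (hcκ : c ≤ lam ^ 2 / 32768) (hcp : c ≤ lam ^ 2 / 96 * μ ^ 2 / 2)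
    (hlog : m * Real.log (Real.exp 1 * (1 / lm + 8)) ≤ ((n + m : ℕ) : ℝ))
    (hN₁ : (1 / (6 * K * μ)) ^ 2 ≤ ((n + m : ℕ) : ℝ))
    (hN₂ : 1 / (36 * K ^ 2 * μ) ≤ lam ^ 2 / 96 * μ ^ 2 / 2 * ((n + m : ℕ) : ℝ))
    (hN₃ : 4 ≤ c * ((n + m : ℕ) : ℝ)) (hN₄ : 1 / lm ≤ ((n + m : ℕ) : ℝ)) :
    matLaw ν n (n + m) {A | subspaceLCD (c * √(n + m : ℕ)) c (rowSpan A)ᗮ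
        < ENNReal.ofReal (c * √(n + m : ℕ) * Real.exp (c * ((n + m : ℕ) : ℝ) / m))}
      ≤ ENNReal.ofReal (Real.exp (-(c * ((n + m : ℕ) : ℝ)))) := by
  have hl := h.lam_pos
  have hK1 : 1 ≤ K := by rw [hK]; linarith [Real.sqrt_nonneg (180 / lam)]
  have hlm0 : 0 < lm := by rw [hlm]; positivity
  have hm' : (1 : ℝ) ≤ m := by exact_mod_cast hm
  have hn' : (m : ℝ) ≤ n := by exact_mod_cast hn
  have hlev : ∀ D, lm * √(n + m : ℕ) ≤ D →
      D ≤ √(n + m : ℕ) * Real.exp (c * ((n + m : ℕ) : ℝ) / m) → _ := fun D hD hDL =>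
    matLaw_level_le_exp h hm hn hK1 hlm0 hμ0 (by linarith) hD hDL hlog hμ (by
      rw [← div_le_iff₀' (by positivity)]
      exact Real.le_sqrt_of_sq_le hN₁) hcp hN₂
  have hNn : ((n + m : ℕ) : ℝ) ≤ 2 * n := by push_cast; linarith
  have hop := matLaw_opNorm_le h (Nat.le_add_right n m)
  set N : ℕ := n + m with hN
  have hNpos : 0 < N := by omega
  set s := √(N : ℝ) with hs
  have hs2 : s ^ 2 = N := Real.sq_sqrt (by positivity)
  have hs0 : 0 < s := Real.sqrt_pos.2 (by exact_mod_cast hNpos)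
  -- With `γ = 1 / (6 K)` the image of the approximation error has norm at most `s / 3`, and `N / 9
  -- ≤ n / 4` because `N ≤ 2n`.
  have hsmall := matLaw_small_denominator_le h (n := n) (N := N) (K := K * s) (γ := 1 / (6 * K))
    (R := lm * s) (by positivity) (by rw [div_le_one (by positivity)]; linarith) (by
      have : K * s * (2 * (1 / (6 * K))) = s / 3 := by field_simp; norm_num
      rw [this, div_pow, hs2]; linarith)
  set L := c * s * Real.exp (c * N / m) with hL
  -- The constraint `2 ^ k * (lm * s) < L` is part of the event, so levels beyond the threshold are
  -- empty. It forces `2 ^ k < e^{2N} ≤ 2^{3N}`, hence `3 N` levels suffice.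
  set F : ℕ → Set (Fin n → Fin N → ℝ) := fun k => {A | 2 ^ k * (lm * s) < L ∧
    ‖matMap A‖ ≤ K * s ∧ ∃ x, ‖x‖ = 1 ∧ matMap A x = 0 ∧
        FarFromLattice (1 / (6 * K)) (μ * s) (2 ^ k * (lm * s)) x ∧
        ∃ θ, 2 ^ k * (lm * s) ≤ θ ∧ θ < 2 * (2 ^ k * (lm * s)) ∧
          latDist (θ • x) < min (1 / (6 * K) * θ) (μ * s)} with hF
  set E₀ : Set (Fin n → Fin N → ℝ) := {A | 2 * √(180 / lam) * s < ‖matMap A‖}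
  set E₁ : Set (Fin n → Fin N → ℝ) := {A | ‖matMap A‖ ≤ K * s ∧ ∃ x, ‖x‖ = 1 ∧ matMap A x = 0 ∧
        ∃ θ, 0 < θ ∧ θ < lm * s ∧ latDist (θ • x) < 1 / (6 * K) * θ}
  have hLle : L ≤ s * Real.exp (c * N / m) := by
    rw [hL]; gcongr; exact mul_le_of_le_one_left hs0.le (by linarith)
  have hcN : c * N / m ≤ N := by
    rw [div_le_iff₀ (by linarith)]
    have : (0 : ℝ) ≤ N := Nat.cast_nonneg N
    nlinarith
  have hNexp : (N : ℝ) ≤ Real.exp N := by linarith [Real.add_one_le_exp (N : ℝ)]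
  have hsub : {A : Fin n → Fin N → ℝ | subspaceLCD (c * s) c (rowSpan A)ᗮ < ENNReal.ofReal L}
      ⊆ E₀ ∪ (E₁ ∪ ⋃ k ∈ Finset.range (3 * N), F k) := by
    intro A hA
    obtain ⟨x, hxE, hx, θ, hθ, hθL, hd⟩ := exists_of_subspaceLCD_lt hA
    by_cases hop' : ‖matMap A‖ ≤ K * s
    swap
    · left
      refine lt_of_le_of_lt ?_ (not_le.1 hop')
      rw [hK]; gcongr; linarith
    right
    have hAx := matMap_eq_zero_of_mem hxE
    -- The denominator condition weakens as its parameters grow, so a single `c` below both `1 / (6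
    -- K)` and `μ` serves for both.
    have hd' : latDist (θ • x) < min (1 / (6 * K) * θ) (μ * s) :=
      hd.trans_le (min_le_min (by gcongr) (by gcongr))
    rcases exists_dyadic_level (R := lm * s) (by positivity) ⟨θ, hθ, hθL, hd'⟩ with
      ⟨θ', h1, h2, h3⟩ | ⟨k, hk, hfar, hθ'⟩
    · left
      exact ⟨hop', x, hx, hAx, θ', h1, h2, h3.trans_le (min_le_left _ _)⟩
    · right
      refine Set.mem_biUnion (x := k) ?_ ⟨hk, hop', x, hx, hAx, hfar, hθ'⟩
      rw [SetLike.mem_coe, Finset.mem_range]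
      have h1 : 2 ^ k * lm < Real.exp N := by
        have h2 : (2 ^ k * lm) * s < Real.exp N * s := by
          calc (2 ^ k * lm) * s = 2 ^ k * (lm * s) := by ring
            _ < s * Real.exp (c * N / m) := hk.trans_le hLle
            _ ≤ s * Real.exp N := by gcongr
            _ = _ := mul_comm _ _
        exact lt_of_mul_lt_mul_right h2 hs0.le
      have h3 : (2 : ℝ) ^ k < 2 ^ (3 * N) := by
        refine lt_of_lt_of_le ?_ (exp_two_mul_le_two_pow N)
        rw [two_mul, Real.exp_add]
        rw [← lt_div_iff₀ hlm0, ← mul_one_div] at h1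
        refine h1.trans_le ?_
        gcongr
        exact hN₄.trans hNexp
      exact (pow_lt_pow_iff_right₀ one_lt_two).1 h3
  have hFk : ∀ k ∈ Finset.range (3 * N), matLaw ν n N (F k)
      ≤ ENNReal.ofReal (Real.exp (-2 * N)) := by
    intro k _
    by_cases hk : 2 ^ k * (lm * s) < L
    · refine (measure_mono ?_).trans (hlev (2 ^ k * (lm * s)) ?_ (hk.le.trans hLle))
      · exact fun A hA => hA.2
      · exact le_mul_of_one_le_left (by positivity) (one_le_pow₀ one_le_two)
    · have : F k = ∅ := by ext A; simp [hF, hk]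
      rw [this]; simp
  have hE₁ : matLaw ν n N E₁ ≤ ENNReal.ofReal (Real.exp (-(2 * (c * N)))) := by
    refine hsmall.trans (ENNReal.ofReal_le_ofReal ?_)
    have hcard := card_latticeBall_small_le (N := N) (κ := lam ^ 2 / 1024) (by positivity)
    rw [← hlm] at hcard
    calc _ ≤ Real.exp (lam ^ 2 / 1024 / 16 * N) * Real.exp (-(lam ^ 2 / 4096 * n)) := by gcongr
      _ ≤ _ := by
        rw [← Real.exp_add, Real.exp_le_exp]
        have h1 : lam ^ 2 / 4096 * (N : ℝ) ≤ lam ^ 2 / 4096 * (2 * n) := by gcongr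
        have h2 : c * N ≤ lam ^ 2 / 32768 * N := by gcongr
        linarith
  have hE₀ : matLaw ν n N E₀ ≤ ENNReal.ofReal (Real.exp (-(2 * (c * N)))) := by
    refine hop.trans (ENNReal.ofReal_le_ofReal (Real.exp_le_exp.2 ?_))
    have : (0 : ℝ) ≤ N := Nat.cast_nonneg N
    nlinarith
  have hEF : matLaw ν n N (⋃ k ∈ Finset.range (3 * N), F k)
      ≤ ENNReal.ofReal (3 * Real.exp (-(2 * (c * N)))) := by
    calc _ ≤ ∑ k ∈ Finset.range (3 * N), ENNReal.ofReal (Real.exp (-2 * N)) :=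
          (measure_biUnion_finset_le _ _).trans (Finset.sum_le_sum hFk)
      _ = ENNReal.ofReal (3 * (N * Real.exp (-2 * N))) := by
          rw [Finset.sum_const, Finset.card_range, nsmul_eq_mul, ← ENNReal.ofReal_natCast,
            ← ENNReal.ofReal_mul (Nat.cast_nonneg _)]
          congr 1; push_cast; ring
      _ ≤ _ := by
          refine ENNReal.ofReal_le_ofReal ?_
          gcongr
          calc N * Real.exp (-2 * N) ≤ Real.exp N * Real.exp (-2 * N) := by gcongr
            _ ≤ _ := by
              rw [← Real.exp_add, Real.exp_le_exp]
              have : (0 : ℝ) ≤ N := Nat.cast_nonneg N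
              nlinarith
  calc _ ≤ matLaw ν n N E₀ + (matLaw ν n N E₁
        + matLaw ν n N (⋃ k ∈ Finset.range (3 * N), F k)) :=
        (measure_mono hsub).trans ((measure_union_le _ _).trans
          (add_le_add le_rfl (measure_union_le _ _)))
    _ ≤ ENNReal.ofReal (Real.exp (-(2 * (c * N)))) + (ENNReal.ofReal (Real.exp (-(2 * (c * N))))
        + ENNReal.ofReal (3 * Real.exp (-(2 * (c * N))))) := by gcongr
    _ = ENNReal.ofReal (5 * Real.exp (-(2 * (c * N)))) := by
        rw [← ENNReal.ofReal_add (by positivity) (by positivity),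
          ← ENNReal.ofReal_add (by positivity) (by positivity)]
        congr 1; ring
    _ ≤ _ := by
        refine ENNReal.ofReal_le_ofReal ?_
        calc 5 * Real.exp (-(2 * (c * N))) ≤ Real.exp (c * N) * Real.exp (-(2 * (c * N))) := by
              gcongr
              linarith [Real.add_one_le_exp (c * N)]
          _ = _ := by rw [← Real.exp_add]; congr 1; ring

/-- The structure theorem for the kernel of a random matrix with entries of law `ν`. -/
lemma exists_matLaw_subspaceLCD_le {lam : ℝ} (hl : 0 < lam) :
    ∃ c ct : ℝ, (0 < c ∧ c < 1) ∧ (0 < ct ∧ ct < 1 / 2) ∧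
      ∀ (ν : Measure ℝ) [IsProbabilityMeasure ν], IsStdSubgaussian ν lam → ∀ n m : ℕ, 1 ≤ m →
        (m : ℝ) < ct * ((n + m : ℕ) : ℝ) →
        matLaw ν n (n + m) {A | subspaceLCD (c * √(n + m : ℕ)) c (rowSpan A)ᗮ
          < ENNReal.ofReal (c * √(n + m : ℕ) * Real.exp (c * ((n + m : ℕ) : ℝ) / m))}
          ≤ ENNReal.ofReal (Real.exp (-(c * ((n + m : ℕ) : ℝ)))) := by
  obtain ⟨K, hK⟩ : ∃ K, K = 2 * √(180 / lam) + 1 := ⟨_, rfl⟩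
  have hK0 : 0 < K := by rw [hK]; positivity
  obtain ⟨lm, hlm⟩ : ∃ lm : ℝ, lm = (lam ^ 2 / 1024) ^ 2 / 4096 := ⟨_, rfl⟩
  have hlm0 : 0 < lm := by rw [hlm]; positivity
  obtain ⟨C₁, hC₁⟩ : ∃ C₁, C₁ = Real.exp 1 * (1 / lm + 8) := ⟨_, rfl⟩
  have hC₁1 : 1 ≤ C₁ := by
    have := Real.add_one_le_exp (1 : ℝ)
    have : 0 < 1 / lm := by positivity
    rw [hC₁]; nlinarith
  obtain ⟨C, hC⟩ : ∃ C, C = C₁ * Real.exp 1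
      * (3 * (5 / 2 * √(Real.pi / (lam ^ 2 / 96)) + 1) * (36 * K ^ 2)) := ⟨_, rfl⟩
  have hC0 : 0 < C := by rw [hC]; positivity
  obtain ⟨μ, hμ⟩ : ∃ μ, μ = Real.exp (-8) / C := ⟨_, rfl⟩
  have hμ0 : 0 < μ := by rw [hμ]; positivity
  obtain ⟨c, hc0, hc, hcγ, hcμ, hcκ, hcp⟩ : ∃ c : ℝ, 0 < c ∧ c ≤ 1 / 4 ∧ c ≤ 1 / (6 * K) ∧ c ≤ μ ∧
      c ≤ lam ^ 2 / 32768 ∧ c ≤ lam ^ 2 / 96 * μ ^ 2 / 2 :=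
    ⟨min (1 / 4) (min (1 / (6 * K)) (min μ (min (lam ^ 2 / 32768) (lam ^ 2 / 96 * μ ^ 2 / 2)))),
      by positivity, by simp, by simp, by simp, by simp, by simp⟩
  -- `X` collects every lower bound required of `N`. Since `m ≥ 1`, the condition `m < N / X`
  -- already forces `N > X`, so no separate assumption that `N` is large is needed.
  obtain ⟨X, hX⟩ : ∃ X : ℝ, X = 3 + Real.log C₁ + (1 / (6 * K * μ)) ^ 2
      + 1 / (36 * K ^ 2 * μ) / (lam ^ 2 / 96 * μ ^ 2 / 2) + 4 / c + 1 / lm := ⟨_, rfl⟩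
  have hlog0 : 0 ≤ Real.log C₁ := Real.log_nonneg hC₁1
  have p1 : 0 ≤ (1 / (6 * K * μ)) ^ 2 := by positivity
  have p2 : 0 ≤ 1 / (36 * K ^ 2 * μ) / (lam ^ 2 / 96 * μ ^ 2 / 2) := by positivity
  have p3 : 0 ≤ 4 / c := by positivity
  have p4 : 0 ≤ 1 / lm := by positivity
  have hX3 : 3 ≤ X := by linarith
  refine ⟨c, 1 / X, ⟨hc0, by linarith⟩, ⟨by positivity, ?_⟩, ?_⟩
  · rw [div_lt_div_iff₀ (by linarith) (by norm_num)]; linarith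
  intro ν _ h n m hm hmN
  have hm' : (1 : ℝ) ≤ m := by exact_mod_cast hm
  rw [one_div, ← div_eq_inv_mul, lt_div_iff₀ (by linarith)] at hmN
  have hNX : X ≤ ((n + m : ℕ) : ℝ) := by nlinarith
  refine matLaw_subspaceLCD_le h hm ?_ hK hlm hμ0 ?_ hc0 hc hcγ hcμ hcκ hcp ?_ ?_ ?_ ?_ ?_
  · have h1 : (m : ℝ) * 3 ≤ n + m := by
      push_cast at hmN; nlinarith
    have h2 : (m : ℝ) ≤ n := by linarith
    exact_mod_cast h2
  · rw [← hC₁, ← hC, hμ]; field_simp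
  · rw [← hC₁]
    refine le_trans ?_ hmN.le
    gcongr
    linarith
  · linarith
  · rw [← div_le_iff₀' (by positivity)]; linarith
  · rw [← div_le_iff₀' hc0]; linarith
  · linarith

end

/-! ### The theorem for random variables. -/

theorem mainTheorem4 :
    ∀ B : ℝ, ∃ c ctilde : ℝ, (0 < c ∧ c < 1) ∧ (0 < ctilde ∧ ctilde < 1 / 2) ∧
      ∀ (Ω : Type*) [MeasurableSpace Ω] (μ : Measure Ω) [IsProbabilityMeasure μ]
        (N m : ℕ) (ξ : Fin (N - m) → Fin N → Ω → ℝ),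
        1 ≤ m → (m : ℝ) < ctilde * (N : ℝ) →
        (∀ i j, Measurable (ξ i j)) →
        iIndepFun (fun p : Fin (N - m) × Fin N => ξ p.1 p.2) μ →
        (∀ i j i' j', IdentDistrib (ξ i j) (ξ i' j') μ μ) →
        (∀ i j, IsSubgaussian (ξ i j) μ ∧ subgaussianMoment (ξ i j) μ ≤ B) →
        (∀ i j, ∫ ω, ξ i j ω ∂μ = 0) →
        (∀ i j, variance (ξ i j) μ = 1) →
        μ.real {ω | subspaceLCD (c * Real.sqrt N) c (rowSpan fun i j => ξ i j ω)ᗮ <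
            ENNReal.ofReal (c * Real.sqrt N * Real.exp (c * N / m))} ≤
          Real.exp (-(c * N)) := by
  intro B
  obtain ⟨c, ct, hc, hct, hmain⟩ :=
    exists_matLaw_subspaceLCD_le (lam := 1 / (2 * (|B| + 1) ^ 2)) (by positivity)
  refine ⟨c, ct, hc, hct, ?_⟩
  intro Ω _ μ _ N m
  -- The truncated difference becomes a variable before `ξ` is introduced, so that `N` can be
  -- replaced by `n + m` without casts in the type of `ξ`.
  generalize hn : N - m = n
  intro ξ hm hmN hmeas hind hident hsub hmean hvar
  have hm' : (1 : ℝ) ≤ m := by exact_mod_cast hm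
  have hN0 : (0 : ℝ) ≤ N := Nat.cast_nonneg N
  have hmN2 : (2 * m : ℝ) < N := by nlinarith [hct.2]
  have hlt : 2 * m < N := by exact_mod_cast hmN2
  obtain rfl : N = n + m := by omega
  have i₀ : Fin n := ⟨0, by omega⟩
  have j₀ : Fin (n + m) := ⟨0, by omega⟩
  have hprob : IsProbabilityMeasure (μ.map (ξ i₀ j₀)) :=
    Measure.isProbabilityMeasure_map (hmeas i₀ j₀).aemeasurable
  have hstd := (hsub i₀ j₀).1.isStdSubgaussian (hmeas i₀ j₀) (hsub i₀ j₀).2 (hmean i₀ j₀)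
    (hvar i₀ j₀)
  have hlaw := map_eq_matLaw hmeas hind fun i j => (hident i j i₀ j₀).map_eq
  have hM : Measurable fun ω i j => ξ i j ω := by fun_prop
  -- This inequality for the image measure holds for every set, so measurability of the event is not
  -- needed.
  have hle := (Measure.le_map_apply hM.aemeasurable _).trans
    (hlaw ▸ hmain (μ.map (ξ i₀ j₀)) hstd n m hm hmN)
  exact ENNReal.toReal_le_of_le_ofReal (Real.exp_pos _).le hle
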